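/- Let $m_+,m_-\ge 1$ be integers and let $F$ be a homogeneous polynomial of degree $4$ on $\mathbb R^{2(m_++m_-)+2}$ with $|\nabla F|^2=16|x|^6$ and $\Delta F=8(m_--m_+)|x|^2$ (the Cartan–Münzner polynomial of an isoparametric family with four principal curvatures and multiplicities $m_+,m_-$). Let $M_+=\{x:|x|=1,\ F(x)=1\}$ be its focal manifold and let $o\in M_+$. Let $n_0,\dots,n_{m_+}$ be an orthonormal basis of the normal space of $M_+$ at $o$ in the unit sphere, with shape operators $S_a=S_{n_a}$ and components $p_a(v)=\langle S_av,v\rangle$ of the second fundamental form, extended complex-quadratically to the complexified tangent space. Fix an orthonormal basis of $T_oM_+=E_+\oplus E_-\oplus E_0$, where $E_+,E_-,E_0$ have dimensions $m_-,m_-,m_+$ and are the eigenspaces of $S_0$ for the eigenvalues $1,-1,0$, and let $A_a:E_-\to E_+$, $B_a:E_0\to E_+$, $C_a:E_0\to E_-$ be the corresponding blocks of $S_a$, $1\le a\le m_+$. Let $r\le\min(m_+,m_-)$. The basis is called normalized with spectral data $(\sigma,\Delta)$ of rank $r$ if $$B_1=C_1=\begin{pmatrix}0&0\\0&\sigma\end{pmatrix},\qquad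 A_1=\begin{pmatrix}I&0\\0&\Delta\end{pmatrix},$$ where $\sigma$ is a nonsingular diagonal $r\times r$ matrix, $\Delta=\operatorname{diag}(0,\Theta_1,\dots,\Theta_s)$ is an $r\times r$ matrix consisting of a zero block (possibly empty) followed by $2\times2$ blocks $\Theta_t=\begin{pmatrix}0&f_t\\-f_t&0\end{pmatrix}$ with $0<f_t<1$, and the block of $\sigma$ corresponding to the zero block of $\Delta$ is $I/\sqrt2$. Assume that the basis is normalized in this sense. Write vectors of $\mathbb CE_+\oplus\mathbb CE_-\oplus\mathbb CE_0$ as $(x,y,z)$ with $x=(x_1,x_2)$, $y=(y_1,y_2)$, $z=(z_1,z_2)$ and $x_2,y_2,z_2\in\mathbb C^r$. For $l\ge2$ the basis element $n_l$ is called $r$-null if $p_l$ vanishes at all $(x,y,z)$ satisfying $$y_1=\iota x_1,\quad y_2=-x_2,\quad z_2=\sigma^{-1}(\Delta+\iota I)x_2,\quad \iota=\pm\sqrt{-1},$$ and the basis is called $r$-null if all $n_l$, $l\ge 2$, are $r$-null. Condition A holds at $o$ if the shape operators of $M_+$ at $o$ in all unit normal directions have the same kernel. Then: 1. For every $l$ with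 $2\le l\le m_+$, $n_l$ is $r$-null if and only if the upper-left $(m_--r)\times(m_+-r)$ blocks of $B_l$ and of $C_l$ are both zero. 2. Condition A holds at $o$ if and only if $r=0$ and the basis is $0$-null. 3. Condition A holds at $o$ if and only if every normalized normal basis at $o$ (with any spectral data, of any rank) has rank $0$ and is $0$-null. -/

import Mathlib

open scoped ContDiff RealInnerProductSpace

/-- The Euclidean space `ℝ^{2(m₊+m₋)+2}`, whose unit sphere `S^{2(m₊+m₋)+1}` is the ambient sphere. -/
abbrev Ambient (mp mm : ℕ) : Type := EuclideanSpace ℝ (Fin (2 * (mp + mm) + 2))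

/-- `F` is a Cartan–Münzner polynomial of degree `g = 4` with multiplicity pair `(m₊, m₋)`: a
homogeneous polynomial of degree `4` with `|∇F|² = 16 |x|⁶` and `ΔF = 8 (m₋ - m₊) |x|²`. The
level sets `F = c`, `-1 < c < 1`, in the unit sphere are the isoparametric hypersurfaces (with four
principal curvatures, hence with positive multiplicities) of the family. -/
structure IsCartanMunzner (mp mm : ℕ) (F : MvPolynomial (Fin (2 * (mp + mm) + 2)) ℝ) : Prop where
  one_le_mp : 1 ≤ mp
  one_le_mm : 1 ≤ mm
  homogeneous : F.IsHomogeneous 4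
  gradient_sq : ∑ i, (MvPolynomial.pderiv i F) ^ 2 =
    MvPolynomial.C 16 * (∑ i, (MvPolynomial.X i) ^ 2) ^ 3
  laplacian : ∑ i, MvPolynomial.pderiv i (MvPolynomial.pderiv i F) =
    MvPolynomial.C (8 * ((mm : ℝ) - (mp : ℝ))) * ∑ i, (MvPolynomial.X i) ^ 2

/-- The focal manifold `M₊ = f⁻¹(1)`, where `f` is the restriction of `F` to the unit sphere. -/
def focalPlus {mp mm : ℕ} (F : MvPolynomial (Fin (2 * (mp + mm) + 2)) ℝ) : Set (Ambient mp mm) :=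
  {x | ‖x‖ = 1 ∧ MvPolynomial.eval (fun i => x i) F = 1}

section Submanifold

variable {E : Type*} [NormedAddCommGroup E] [InnerProductSpace ℝ E]

/-- `γ` is a smooth curve lying in `M` that starts at `x`. -/
structure IsSmoothCurveAt (M : Set E) (x : E) (γ : ℝ → E) : Prop where
  smooth : ContDiff ℝ ∞ γ
  mem : ∀ t, γ t ∈ M
  start : γ 0 = x

/-- The vectors tangent to `M` at `x`: the velocities of the smooth curves in `M` through `x`. -/
def tangentVectors (M : Set E) (x : E) : Set E :=
  {v | ∃ γ : ℝ → E, IsSmoothCurveAt M x γ ∧ deriv γ 0 = v}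

/-- The subspace `T` is the tangent space of `M` at `x`. -/
def IsTangentSpace (M : Set E) (x : E) (T : Submodule ℝ E) : Prop :=
  (T : Set E) = tangentVectors M x

/-- The normal space, at the point `x` of the unit sphere, of a submanifold of the unit sphere with
tangent space `T` at `x`: the orthogonal complement of `T` in `x^⊥`, the tangent space of the
sphere. -/
noncomputable def normalSpaceInSphere (x : E) (T : Submodule ℝ E) : Submodule ℝ E :=
  (T ⊔ Submodule.span ℝ {x})ᗮ

/-- `S` is the shape operator, in the normal direction `n`, of the submanifold `M` of the unit
sphere at the point `x` with tangent space `T`: the symmetric operator on `T` for which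
`⟨S v, v⟩` is `⟨II(v, v), n⟩`, the `n`-component of the acceleration of any curve in `M` through
`x` with velocity `v`. As `n` is orthogonal to `x`, accelerations in the sphere and in the
Euclidean space have the same `n`-component. -/
structure IsShapeOperator (M : Set E) (x : E) (T : Submodule ℝ E) (n : E) (S : T →ₗ[ℝ] T) :
    Prop where
  symmetric : S.IsSymmetric
  normal_curvature : ∀ γ : ℝ → E, IsSmoothCurveAt M x γ →
    ∀ v : T, deriv γ 0 = (v : E) → ⟪S v, v⟫ = ⟪deriv (deriv γ) 0, n⟫

/-- Condition A of Ozeki and Takeuchi at the point `x` of the submanifold `M` of the unit sphere: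
the shape operators in all (unit) normal directions share the same kernel. -/
def ConditionA (M : Set E) (x : E) : Prop :=
  ∃ T : Submodule ℝ E, IsTangentSpace M x T ∧
    ∃ K : Submodule ℝ T, ∀ n ∈ normalSpaceInSphere x T, ‖n‖ = 1 →
      ∃ S : T →ₗ[ℝ] T, IsShapeOperator M x T n S ∧ LinearMap.ker S = K

end Submanifold

/-- Indices `1, …, m`, split into the first `m - r` and the last `r` ones. -/
abbrev SplitIdx (m r : ℕ) : Type := Fin (m - r) ⊕ Fin r

/-- Indices of a tangent frame adapted to `E₊ ⊕ E₋ ⊕ E₀`, of dimensions `m₋, m₋, m₊`. -/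
abbrev TangentIdx (mp mm r : ℕ) : Type := SplitIdx mm r ⊕ (SplitIdx mm r ⊕ SplitIdx mp r)

/-- A normal basis `n₀, …, n_{m₊}` of `M` at `x`, together with an orthonormal basis of the tangent
space and the shape operators `S₀, …, S_{m₊}`. -/
structure NormalBasis (mp mm r : ℕ) (M : Set (Ambient mp mm)) (x : Ambient mp mm) where
  T : Submodule ℝ (Ambient mp mm)
  isTangentSpace : IsTangentSpace M x T
  n : Fin (mp + 1) → Ambient mp mm
  orthonormal_n : Orthonormal ℝ n
  span_n : Submodule.span ℝ (Set.range n) = normalSpaceInSphere x T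
  e : OrthonormalBasis (TangentIdx mp mm r) ℝ T
  shape : Fin (mp + 1) → (T →ₗ[ℝ] T)
  isShapeOperator : ∀ a, IsShapeOperator M x T (n a) (shape a)

namespace NormalBasis

variable {mp mm r : ℕ} {M : Set (Ambient mp mm)} {x : Ambient mp mm}

/-- The matrix `S_a` of the shape operator in the direction `n_a`. -/
noncomputable def S (D : NormalBasis mp mm r M x) (a : Fin (mp + 1)) :
    Matrix (TangentIdx mp mm r) (TangentIdx mp mm r) ℝ :=
  Matrix.of fun i j => ⟪D.e i, D.shape a (D.e j)⟫

/-- The block `A_a : E₋ → E₊` of `S_a`. -/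
noncomputable def A (D : NormalBasis mp mm r M x) (a : Fin (mp + 1)) :
    Matrix (SplitIdx mm r) (SplitIdx mm r) ℝ :=
  Matrix.of fun i j => D.S a (Sum.inl i) (Sum.inr (Sum.inl j))

/-- The block `B_a : E₀ → E₊` of `S_a`. -/
noncomputable def B (D : NormalBasis mp mm r M x) (a : Fin (mp + 1)) :
    Matrix (SplitIdx mm r) (SplitIdx mp r) ℝ :=
  Matrix.of fun i j => D.S a (Sum.inl i) (Sum.inr (Sum.inr j))

/-- The block `C_a : E₀ → E₋` of `S_a`. -/
noncomputable def C (D : NormalBasis mp mm r M x) (a : Fin (mp + 1)) :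
    Matrix (SplitIdx mm r) (SplitIdx mp r) ℝ :=
  Matrix.of fun i j => D.S a (Sum.inr (Sum.inl i)) (Sum.inr (Sum.inr j))

/-- The component `p_a` of the second fundamental form, as a quadratic form on the
complexification of `E₊ ⊕ E₋ ⊕ E₀`. -/
noncomputable def p (D : NormalBasis mp mm r M x) (a : Fin (mp + 1)) (v : TangentIdx mp mm r → ℂ) : ℂ :=
  v ⬝ᵥ ((D.S a).map Complex.ofReal).mulVec v

end NormalBasis

/-- The matrix `Δ = diag(0, Θ₁, …, Θ_s)` of size `k + 2s` with a zero block of size `k` and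
`2 × 2` blocks `Θ_t` with rows `(0, f_t)` and `(-f_t, 0)`. -/
def deltaMatrix (k s : ℕ) (f : Fin s → ℝ) : Matrix (Fin (k + s * 2)) (Fin (k + s * 2)) ℝ :=
  let c : Fin 2 × Fin s ≃ Fin (s * 2) := (Equiv.prodComm _ _).trans finProdFinEquiv
  Matrix.reindex finSumFinEquiv finSumFinEquiv
    (Matrix.fromBlocks 0 0 0
      (Matrix.reindex c c (Matrix.blockDiagonal fun t => !![0, f t; -f t, 0])))

/-- `(σ, Δ)` are spectral data of rank `r`: `σ` is a nonsingular diagonal matrix, `Δ` is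
`diag(0, Θ₁, …, Θ_s)` with `0 < f_t < 1`, and the block of `σ` at the zero block of `Δ` is
`I/√2`. -/
def IsSpectralData {r : ℕ} (σ Δ : Matrix (Fin r) (Fin r) ℝ) : Prop :=
  ∃ (d : Fin r → ℝ) (k s : ℕ) (f : Fin s → ℝ) (h : k + s * 2 = r),
    (∀ i, d i ≠ 0) ∧ σ = Matrix.diagonal d ∧
    (∀ t, 0 < f t ∧ f t < 1) ∧
    Δ = Matrix.reindex (finCongr h) (finCongr h) (deltaMatrix k s f) ∧
    ∀ i : Fin r, (i : ℕ) < k → d i = 1 / √2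

namespace NormalBasis

variable {mp mm r : ℕ} {M : Set (Ambient mp mm)} {x : Ambient mp mm}

/-- The normal basis is normalized with spectral data `(σ, Δ)`, `r` being the rank of `B₁ = C₁`.
(That the three diagonal blocks of `S_a`, `a ≥ 1`, vanish is automatic on a focal manifold and need
not be required.) -/
structure IsNormalized (D : NormalBasis mp mm r M x) (σ Δ : Matrix (Fin r) (Fin r) ℝ) : Prop where
  le_mp : r ≤ mp
  le_mm : r ≤ mm
  S_zero : D.S 0 = Matrix.diagonal (Sum.elim (fun _ => 1) (Sum.elim (fun _ => -1) fun _ => 0))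
  spectral : IsSpectralData σ Δ
  A_one : D.A 1 = Matrix.fromBlocks 1 0 0 Δ
  B_one : D.B 1 = Matrix.fromBlocks 0 0 0 σ
  C_one : D.C 1 = Matrix.fromBlocks 0 0 0 σ

end NormalBasis

/-- The linear constraints `y₁ = ι x₁`, `y₂ = -x₂`, `z₂ = σ⁻¹ (Δ + ι I) x₂`, `ι = ±√-1`, on
`(x, y, z)` in the complexification of `E₊ ⊕ E₋ ⊕ E₀`. -/
def LinearConstraints {mp mm r : ℕ} (σ Δ : Matrix (Fin r) (Fin r) ℝ)
    (v : TangentIdx mp mm r → ℂ) : Prop :=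
  let x₁ : Fin (mm - r) → ℂ := fun i => v (Sum.inl (Sum.inl i))
  let x₂ : Fin r → ℂ := fun i => v (Sum.inl (Sum.inr i))
  let y₁ : Fin (mm - r) → ℂ := fun i => v (Sum.inr (Sum.inl (Sum.inl i)))
  let y₂ : Fin r → ℂ := fun i => v (Sum.inr (Sum.inl (Sum.inr i)))
  let z₂ : Fin r → ℂ := fun i => v (Sum.inr (Sum.inr (Sum.inr i)))
  ∃ ι : ℂ, (ι = Complex.I ∨ ι = -Complex.I) ∧ y₁ = ι • x₁ ∧ y₂ = -x₂ ∧
    z₂ = ((σ.map Complex.ofReal)⁻¹ * (Δ.map Complex.ofReal + ι • 1)).mulVec x₂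

namespace NormalBasis

variable {mp mm r : ℕ} {M : Set (Ambient mp mm)} {x : Ambient mp mm}

/-- The basis element `n_l` is `r`-null (for a basis normalized with spectral data `(σ, Δ)`). -/
def IsNullAt (D : NormalBasis mp mm r M x) (σ Δ : Matrix (Fin r) (Fin r) ℝ)
    (l : Fin (mp + 1)) : Prop :=
  ∀ v : TangentIdx mp mm r → ℂ, LinearConstraints σ Δ v → D.p l v = 0

/-- The normal basis is `r`-null: all `n_l`, `l ≥ 2`, are `r`-null. -/
def IsNull (D : NormalBasis mp mm r M x) (σ Δ : Matrix (Fin r) (Fin r) ℝ) : Prop :=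
  ∀ l : Fin (mp + 1), 2 ≤ (l : ℕ) → D.IsNullAt σ Δ l

end NormalBasis

/-! ### Homogeneous quartics as symmetric four-linear forms -/

section QuarticPolynomials

open MvPolynomial Matrix

variable {ι : Type*}

/-! The second-order geometry of the focal manifold at a point x is read off the four-linear form of
F. Write Q(a, b) for this form with two slots filled (`quarticMatrix`). At x the gradient is 4x, and
differentiating |∇F|² = 16|x|⁶ twice shows that Q(x, x) is 24 on x and has only the eigenvalues 8
and -24 on the complement of x. Velocities lie in the 8-eigenspace. The Laplacian fixes its
dimension as 2m₋ + m₊, which is also the size of the given tangent frame, so it is the tangent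
space, and normals are -24-eigenvectors. Expanding the same equations at x + tn for a unit normal n
gives S_n = Q(x, n)/16 and S_n³ = S_n (`IsShapeOperator.apply_eq`, `IsShapeOperator.cube`).

Hence (∑ c_a S_a)³ = |c|² ∑ c_a S_a. Polarizing this with S_0 = diag(1, -1, 0) gives quadratic
relations between the blocks A, B, C, and one cubic relation is needed besides. With index 1 in
normal form, these relations express the relevant parts of A_l through B_l and C_l, and on the
constraint set everything in p_l cancels except 2 x₁ᵀ(B₁₁ + ιC₁₁)z₁ (`p_eq`). As B₁₁ and C₁₁ are
real, claim 1 follows.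

Since E₀ = ker S_0, Condition A forces all B_a and C_a to vanish. Conversely, if they vanish, every
unit normal has S_n² = S_0² and so the same kernel. Nonsingularity of σ turns B_1 = 0 into r = 0,
and for r = 0 claim 1 says that 0-nullity is the vanishing of the remaining B_l and C_l. Claim 3 is
claim 2 applied to every normalized basis, the given one providing the converse. -/

theorem MvPolynomial.pderiv_pderiv_comm (i j : ι) (p : MvPolynomial ι ℝ) :
    pderiv i (pderiv j p) = pderiv j (pderiv i p) := by
  classical
  have h : ⁅(pderiv i : Derivation ℝ (MvPolynomial ι ℝ) (MvPolynomial ι ℝ)),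
      (pderiv j : Derivation ℝ (MvPolynomial ι ℝ) (MvPolynomial ι ℝ))⁆ = 0 := by
    refine MvPolynomial.derivation_ext fun k => ?_
    simp only [Derivation.commutator_apply, pderiv_X, Derivation.coe_zero, Pi.zero_apply]
    simp only [Pi.single_apply]
    split_ifs <;> simp
  have h2 := congrArg (fun d => d p) h
  simpa [Derivation.commutator_apply, sub_eq_zero] using h2

theorem MvPolynomial.IsHomogeneous.sum_mul_eval_pderiv [Fintype ι] {p : MvPolynomial ι ℝ} {d : ℕ}
    (hp : p.IsHomogeneous d) (y : ι → ℝ) :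
    ∑ i, y i * eval y (pderiv i p) = d * eval y p := by
  have h := congrArg (eval y) hp.sum_X_mul_pderiv
  simpa using h

theorem MvPolynomial.IsHomogeneous.eval_eq_eval_zero {p : MvPolynomial ι ℝ}
    (hp : p.IsHomogeneous 0) (y : ι → ℝ) : eval y p = eval 0 p := by
  rw [← totalDegree_zero_iff_isHomogeneous, totalDegree_eq_zero_iff_eq_C] at hp
  rw [hp]; simp

/-- The fourth partial derivatives at the origin. -/
noncomputable def fourthPartial (F : MvPolynomial ι ℝ) (i j k l : ι) : ℝ :=
  eval 0 (pderiv l (pderiv k (pderiv j (pderiv i F))))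

/-- The matrix of the fourth derivative of `F`, contracted with two vectors. -/
noncomputable def quarticMatrix [Fintype ι] (F : MvPolynomial ι ℝ) (a b : ι → ℝ) : Matrix ι ι ℝ :=
  Matrix.of fun i j => ∑ k, ∑ l, fourthPartial F i j k l * a k * b l

/-- The gradient of `F` at a point. -/
noncomputable def gradVec (F : MvPolynomial ι ℝ) (y : ι → ℝ) : ι → ℝ :=
  fun i => eval y (pderiv i F)

variable (F : MvPolynomial ι ℝ)

theorem fourthPartial_swap₁₂ (i j k l : ι) : fourthPartial F i j k l = fourthPartial F j i k l := by
  unfold fourthPartial; rw [pderiv_pderiv_comm j i]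

theorem fourthPartial_swap₂₃ (i j k l : ι) : fourthPartial F i j k l = fourthPartial F i k j l := by
  unfold fourthPartial; rw [pderiv_pderiv_comm k j]

theorem fourthPartial_swap₃₄ (i j k l : ι) : fourthPartial F i j k l = fourthPartial F i j l k := by
  unfold fourthPartial; rw [pderiv_pderiv_comm l k]

variable [Fintype ι]

theorem quarticMatrix_transpose (a b : ι → ℝ) : (quarticMatrix F a b)ᵀ = quarticMatrix F a b := by
  ext i j
  simp only [quarticMatrix, transpose_apply, of_apply]
  simp_rw [fourthPartial_swap₁₂ F j i]

theorem quarticMatrix_comm (a b : ι → ℝ) : quarticMatrix F a b = quarticMatrix F b a := by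
  ext i j
  simp only [quarticMatrix, of_apply]
  rw [Finset.sum_comm]
  refine Finset.sum_congr rfl fun k _ => Finset.sum_congr rfl fun l _ => ?_
  rw [fourthPartial_swap₃₄ F i j l k]; ring

theorem quarticMatrix_mulVec_comm (a b c : ι → ℝ) :
    quarticMatrix F a b *ᵥ c = quarticMatrix F a c *ᵥ b := by
  ext i
  simp only [quarticMatrix, mulVec, dotProduct, of_apply, Finset.sum_mul]
  calc ∑ j, ∑ k, ∑ l, fourthPartial F i j k l * a k * b l * c j
      = ∑ j, ∑ l, ∑ k, fourthPartial F i j k l * a k * b l * c j :=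
        Finset.sum_congr rfl fun j _ => Finset.sum_comm
    _ = ∑ l, ∑ j, ∑ k, fourthPartial F i j k l * a k * b l * c j := Finset.sum_comm
    _ = ∑ l, ∑ k, ∑ j, fourthPartial F i j k l * a k * b l * c j :=
        Finset.sum_congr rfl fun j _ => Finset.sum_comm
    _ = _ := by
        refine Finset.sum_congr rfl fun l _ => Finset.sum_congr rfl fun k _ =>
          Finset.sum_congr rfl fun j _ => ?_
        rw [fourthPartial_swap₂₃ F i j, fourthPartial_swap₃₄ F i k, fourthPartial_swap₂₃ F i k]
        ring

theorem quarticMatrix_add_left (a a' b : ι → ℝ) :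
    quarticMatrix F (a + a') b = quarticMatrix F a b + quarticMatrix F a' b := by
  ext i j
  simp only [quarticMatrix, of_apply, Matrix.add_apply, Pi.add_apply, mul_add, add_mul,
    Finset.sum_add_distrib]

theorem quarticMatrix_smul_left (t : ℝ) (a b : ι → ℝ) :
    quarticMatrix F (t • a) b = t • quarticMatrix F a b := by
  ext i j
  simp only [quarticMatrix, of_apply, Matrix.smul_apply, Pi.smul_apply, smul_eq_mul, Finset.mul_sum]
  refine Finset.sum_congr rfl fun l _ => Finset.sum_congr rfl fun k _ => ?_
  ring

theorem quarticMatrix_add_right (a b b' : ι → ℝ) :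
    quarticMatrix F a (b + b') = quarticMatrix F a b + quarticMatrix F a b' := by
  rw [quarticMatrix_comm, quarticMatrix_add_left, quarticMatrix_comm F b, quarticMatrix_comm F b']

theorem quarticMatrix_smul_right (t : ℝ) (a b : ι → ℝ) :
    quarticMatrix F a (t • b) = t • quarticMatrix F a b := by
  rw [quarticMatrix_comm, quarticMatrix_smul_left, quarticMatrix_comm]

variable {F}

theorem eval_third_partial (hF : F.IsHomogeneous 4) (y : ι → ℝ) (i j k : ι) :
    eval y (pderiv k (pderiv j (pderiv i F))) = ∑ l, fourthPartial F i j k l * y l := by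
  have h3 : (pderiv k (pderiv j (pderiv i F))).IsHomogeneous 1 := hF.pderiv.pderiv.pderiv
  have h := h3.sum_mul_eval_pderiv y
  rw [Nat.cast_one, one_mul] at h
  rw [← h]
  refine Finset.sum_congr rfl fun l _ => ?_
  have h4 : (pderiv l (pderiv k (pderiv j (pderiv i F)))).IsHomogeneous 0 := h3.pderiv
  rw [h4.eval_eq_eval_zero, mul_comm]; rfl

theorem sum_eval_third_partial (hF : F.IsHomogeneous 4) (y a : ι → ℝ) (i j : ι) :
    ∑ k, a k * eval y (pderiv k (pderiv j (pderiv i F))) = quarticMatrix F a y i j := by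
  simp only [eval_third_partial hF, quarticMatrix, of_apply, Finset.mul_sum]
  refine Finset.sum_congr rfl fun l _ => Finset.sum_congr rfl fun k _ => ?_
  ring

theorem quarticMatrix_self_apply (hF : F.IsHomogeneous 4) (y : ι → ℝ) (i j : ι) :
    quarticMatrix F y y i j = 2 * eval y (pderiv j (pderiv i F)) := by
  rw [← sum_eval_third_partial hF]
  have h2 : (pderiv j (pderiv i F)).IsHomogeneous 2 := hF.pderiv.pderiv
  exact_mod_cast h2.sum_mul_eval_pderiv y

theorem quarticMatrix_self_mulVec_self (hF : F.IsHomogeneous 4) (y : ι → ℝ) :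
    quarticMatrix F y y *ᵥ y = (6 : ℝ) • gradVec F y := by
  ext i
  simp only [mulVec, dotProduct, quarticMatrix_self_apply hF, Pi.smul_apply, smul_eq_mul, gradVec]
  have h1 : (pderiv i F).IsHomogeneous 3 := hF.pderiv
  have h := h1.sum_mul_eval_pderiv y
  push_cast at h
  rw [show (6 : ℝ) * eval y (pderiv i F) = 2 * (3 * eval y (pderiv i F)) by ring, ← h,
    Finset.mul_sum]
  exact Finset.sum_congr rfl fun k _ => by ring

theorem dotProduct_gradVec (hF : F.IsHomogeneous 4) (y : ι → ℝ) :
    y ⬝ᵥ gradVec F y = 4 * eval y F := by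
  exact_mod_cast hF.sum_mul_eval_pderiv y

theorem gradVec_dotProduct_self
    (h : ∑ i, (pderiv i F) ^ 2 = C 16 * (∑ i, (X i) ^ 2) ^ 3) (y : ι → ℝ) :
    gradVec F y ⬝ᵥ gradVec F y = 16 * (y ⬝ᵥ y) ^ 3 := by
  have h1 := congrArg (eval y) h
  simp only [map_sum, map_pow, map_mul, eval_C, eval_X] at h1
  simp only [dotProduct, gradVec, ← pow_two]
  exact h1

theorem sum_smul_pderiv_X (j : ι) :
    ∑ i, 2 • (X i : MvPolynomial ι ℝ) ^ (2 - 1) • pderiv j (X i : MvPolynomial ι ℝ) = 2 * X j := by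
  rw [Finset.sum_eq_single j]
  · simp
  · intro b _ hb
    simp [pderiv_X_of_ne hb]
  · simp

theorem sum_gradient_mul_hessian
    (h : ∑ i, (pderiv i F) ^ 2 = C 16 * (∑ i, (X i) ^ 2) ^ 3) (j : ι) :
    ∑ i, pderiv i F * pderiv j (pderiv i F) = C 48 * (∑ i, (X i) ^ 2) ^ 2 * X j := by
  have h1 := congrArg (pderiv j) h
  have h2 := sum_smul_pderiv_X (ι := ι) j
  simp only [map_sum, Derivation.leibniz_pow, Derivation.leibniz, pderiv_C, smul_zero,
    add_zero] at h1
  rw [h2] at h1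
  simp only [smul_eq_mul, nsmul_eq_mul, Nat.add_one_sub_one, pow_one] at h1
  rw [← Finset.mul_sum] at h1
  push_cast at h1
  have h3 : (2 : MvPolynomial ι ℝ) ≠ 0 := two_ne_zero
  apply mul_left_cancel₀ h3
  rw [h1, show (C 48 : MvPolynomial ι ℝ) = 3 * C 16 by
    rw [show (3 : MvPolynomial ι ℝ) = C 3 from rfl, ← C_mul]; norm_num]
  ring

/-- The second derivative of the gradient equation, multiplied by 4 because Q(y, y) is twice the
Hessian. -/
theorem hessian_identity [DecidableEq ι] (hF : F.IsHomogeneous 4)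
    (h : ∑ i, (pderiv i F) ^ 2 = C 16 * (∑ i, (X i) ^ 2) ^ 3) (y : ι → ℝ) :
    quarticMatrix F y y * quarticMatrix F y y + (4 : ℝ) • quarticMatrix F (gradVec F y) y =
      (192 : ℝ) • ((y ⬝ᵥ y) ^ 2 • 1 + (4 * (y ⬝ᵥ y)) • vecMulVec y y) := by
  ext j k
  have h1 := congrArg (fun p => eval y (pderiv k p)) (sum_gradient_mul_hessian h j)
  have h2 := sum_smul_pderiv_X (ι := ι) k
  simp only [map_sum, Derivation.leibniz, Derivation.leibniz_pow, pderiv_C, smul_zero,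
    add_zero] at h1
  rw [h2] at h1
  simp only [smul_eq_mul, nsmul_eq_mul, map_add, map_mul, map_sum, map_pow, eval_C, eval_X,
    Finset.sum_add_distrib] at h1
  have e1 : (quarticMatrix F y y * quarticMatrix F y y) j k =
      4 * ∑ i, eval y (pderiv j (pderiv i F)) * eval y (pderiv k (pderiv i F)) := by
    rw [mul_apply, Finset.mul_sum]
    refine Finset.sum_congr rfl fun i _ => ?_
    rw [quarticMatrix_self_apply hF, quarticMatrix_self_apply hF, pderiv_pderiv_comm j i]
    ring
  have e2 : quarticMatrix F (gradVec F y) y j k =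
      ∑ i, eval y (pderiv i F) * eval y (pderiv k (pderiv j (pderiv i F))) := by
    rw [← sum_eval_third_partial hF]
    refine Finset.sum_congr rfl fun i _ => ?_
    rw [pderiv_pderiv_comm i k, pderiv_pderiv_comm i j]; rfl
  have e3 : eval y (pderiv k (X j : MvPolynomial ι ℝ)) = (1 : Matrix ι ι ℝ) j k := by
    rw [pderiv_X, one_apply, Pi.single_apply]
    split_ifs <;> simp_all
  rw [e3] at h1
  have e4 : y ⬝ᵥ y = ∑ i, y i ^ 2 := by simp only [dotProduct, pow_two]
  simp only [Matrix.add_apply, Matrix.smul_apply, smul_eq_mul, e1, e2, e4, vecMulVec_apply]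
  rw [← mul_add, add_comm, h1]
  simp
  ring

end QuarticPolynomials

/-! ### Spectrum of the Hessian at a focal point and expansion along normals -/

section NormalDirections

open MvPolynomial Matrix

/-- Five sample points determine a polynomial of degree four. -/
theorem quartic_coeffs_eq_zero {c₀ c₁ c₂ c₃ c₄ : ℝ}
    (h : ∀ t : ℝ, c₀ + t * c₁ + t ^ 2 * c₂ + t ^ 3 * c₃ + t ^ 4 * c₄ = 0) :
    c₁ = 0 ∧ c₂ = 0 ∧ c₃ = 0 := by
  have h0 := h 0
  have h1 := h 1
  have h2 := h (-1)
  have h3 := h 2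
  have h4 := h (-2)
  norm_num at h0 h1 h2 h3 h4
  refine ⟨?_, ?_, ?_⟩ <;> linarith

variable {ι : Type*} [Fintype ι] {F : MvPolynomial ι ℝ}

theorem dotProduct_quarticMatrix_mulVec (F : MvPolynomial ι ℝ) (a b u w : ι → ℝ) :
    u ⬝ᵥ quarticMatrix F a b *ᵥ w = (quarticMatrix F a b *ᵥ u) ⬝ᵥ w := by
  rw [dotProduct_mulVec, ← mulVec_transpose, quarticMatrix_transpose]

theorem dotProduct_eq_zero_of_quarticMatrix_mulVec {x n v : ι → ℝ}
    (hn' : quarticMatrix F x x *ᵥ n = (-24 : ℝ) • n)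
    (hv : quarticMatrix F x x *ᵥ v = (8 : ℝ) • v) : n ⬝ᵥ v = 0 := by
  have h1 := dotProduct_quarticMatrix_mulVec F x x n v
  rw [hn', hv, dotProduct_smul, smul_dotProduct, smul_eq_mul, smul_eq_mul] at h1
  linarith

/-- `F` is a homogeneous quartic with `|∇F|² = 16 |x|⁶` and `x` is a unit vector with `F x = 1`. -/
structure IsFocalPoint (F : MvPolynomial ι ℝ) (x : ι → ℝ) : Prop where
  homogeneous : F.IsHomogeneous 4
  gradient_sq : ∑ i, (pderiv i F) ^ 2 = C 16 * (∑ i, (X i) ^ 2) ^ 3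
  dot_self : x ⬝ᵥ x = 1
  eval_eq : eval x F = 1

namespace IsFocalPoint

variable {x : ι → ℝ} (h : IsFocalPoint F x)
include h

/-- Equality in Cauchy–Schwarz: the gradient has length 4, and its product with the unit vector x is
4F(x) = 4. -/
theorem gradVec_eq : gradVec F x = (4 : ℝ) • x := by
  have h1 := gradVec_dotProduct_self h.gradient_sq x
  have h2 := dotProduct_gradVec h.homogeneous x
  have h3 : (gradVec F x - (4 : ℝ) • x) ⬝ᵥ (gradVec F x - (4 : ℝ) • x) = 0 := by
    simp only [sub_dotProduct, dotProduct_sub, smul_dotProduct, dotProduct_smul, smul_eq_mul,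
      dotProduct_comm (gradVec F x) x, h1, h2, h.dot_self, h.eval_eq]
    norm_num
  exact sub_eq_zero.mp (dotProduct_self_eq_zero.mp h3)

theorem mulVec_self : quarticMatrix F x x *ᵥ x = (24 : ℝ) • x := by
  rw [quarticMatrix_self_mulVec_self h.homogeneous, h.gradVec_eq, smul_smul]
  norm_num

theorem dot_eq_zero {v : ι → ℝ} {c : ℝ} (hc : c ≠ 24) (hv : quarticMatrix F x x *ᵥ v = c • v) :
    x ⬝ᵥ v = 0 := by
  have h1 := dotProduct_quarticMatrix_mulVec F x x x v
  rw [hv, h.mulVec_self, dotProduct_smul, smul_dotProduct, smul_eq_mul, smul_eq_mul] at h1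
  have : (c - 24) * (x ⬝ᵥ v) = 0 := by linarith
  exact (mul_eq_zero.mp this).resolve_left (sub_ne_zero.mpr hc)

theorem six_smul_gradVec_add_smul {n : ι → ℝ}
    (hn' : quarticMatrix F x x *ᵥ n = (-24 : ℝ) • n) (t : ℝ) : (6 : ℝ) • gradVec F (x + t • n) =
    (24 : ℝ) • x - (72 * t) • n + (3 * t ^ 2) • (quarticMatrix F n n *ᵥ x) +
      t ^ 3 • (quarticMatrix F n n *ᵥ n) := by
  rw [← quarticMatrix_self_mulVec_self h.homogeneous]
  simp only [quarticMatrix_add_left, quarticMatrix_add_right, quarticMatrix_smul_left,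
    quarticMatrix_smul_right, add_mulVec, mulVec_add, smul_mulVec, mulVec_smul]
  rw [quarticMatrix_comm F n x, quarticMatrix_mulVec_comm F x n x, quarticMatrix_comm F x n,
    quarticMatrix_mulVec_comm F n x n, h.mulVec_self, hn']
  module

/-- On the complement of x this reads (Q - 8)(Q + 24) = 0, which separates tangent from normal
directions. -/
theorem sq_eq [DecidableEq ι] : quarticMatrix F x x * quarticMatrix F x x =
    (192 : ℝ) • 1 - (16 : ℝ) • quarticMatrix F x x + (768 : ℝ) • vecMulVec x x := by
  have h1 := hessian_identity h.homogeneous h.gradient_sq x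
  rw [h.gradVec_eq, quarticMatrix_smul_left, h.dot_self, smul_smul] at h1
  rw [eq_sub_of_add_eq h1]
  norm_num [smul_smul]
  abel

variable {n : ι → ℝ} (hn : n ⬝ᵥ n = 1) (hn' : quarticMatrix F x x *ᵥ n = (-24 : ℝ) • n)
include hn hn'

/-- In effect n is itself a focal point, with x as one of its normals. This comes from comparing
powers of t in |∇F(x + tn)|² = 16|x + tn|⁶. -/
theorem normal_mulVec : quarticMatrix F n n *ᵥ x = (-24 : ℝ) • x ∧
    quarticMatrix F n n *ᵥ n = (24 : ℝ) • n := by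
  set u := quarticMatrix F n n *ᵥ x with hu
  set w := quarticMatrix F n n *ᵥ n with hw
  have hxn : x ⬝ᵥ n = 0 := h.dot_eq_zero (by norm_num) hn'
  have hxu : x ⬝ᵥ u = -24 := by
    rw [hu, quarticMatrix_mulVec_comm, dotProduct_quarticMatrix_mulVec, quarticMatrix_comm,
      quarticMatrix_mulVec_comm, hn', smul_dotProduct, hn]
    norm_num
  have hxw : x ⬝ᵥ w = n ⬝ᵥ u := by
    rw [hw, dotProduct_quarticMatrix_mulVec, dotProduct_comm]
  have key : ∀ t : ℝ, (-384 * (n ⬝ᵥ u)) * t ^ 3 + (9 * (u ⬝ᵥ u) - 144 * (n ⬝ᵥ w) - 1728) * t ^ 4 +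
      6 * (u ⬝ᵥ w) * t ^ 5 + (w ⬝ᵥ w - 576) * t ^ 6 = 0 := by
    intro t
    have h1 := gradVec_dotProduct_self h.gradient_sq (x + t • n)
    have h2 : ((6 : ℝ) • gradVec F (x + t • n)) ⬝ᵥ ((6 : ℝ) • gradVec F (x + t • n)) =
        576 * ((x + t • n) ⬝ᵥ (x + t • n)) ^ 3 := by
      rw [smul_dotProduct, dotProduct_smul, h1, smul_eq_mul, smul_eq_mul]; ring
    rw [h.six_smul_gradVec_add_smul hn' t, ← hu, ← hw] at h2
    simp only [add_dotProduct, dotProduct_add, sub_dotProduct, dotProduct_sub, smul_dotProduct,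
      dotProduct_smul, smul_eq_mul, dotProduct_comm u x, dotProduct_comm w x, dotProduct_comm n x,
      dotProduct_comm u n, dotProduct_comm w n, dotProduct_comm w u, hxn, hxu, hxw, hn,
      h.dot_self] at h2
    linear_combination h2
  -- Only t³ through t⁶ occur, so four nonzero samples isolate the coefficients.
  have k1 := key 1
  have k2 := key (-1)
  have k3 := key 2
  have k4 := key (-2)
  norm_num at k1 k2 k3 k4
  -- By the t⁴ and t⁶ coefficients these two squared lengths equal 16(n·w - 24) and -48(n·w - 24).
  -- Both are nonnegative, hence both vanish.
  have e1 : (u + (24 : ℝ) • x) ⬝ᵥ (u + (24 : ℝ) • x) = u ⬝ᵥ u - 576 := by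
    simp only [add_dotProduct, dotProduct_add, smul_dotProduct,
      dotProduct_smul, smul_eq_mul, dotProduct_comm u x, hxu, h.dot_self]
    ring
  have e2 : (w - (24 : ℝ) • n) ⬝ᵥ (w - (24 : ℝ) • n) = w ⬝ᵥ w - 48 * (n ⬝ᵥ w) + 576 := by
    simp only [sub_dotProduct, dotProduct_sub, smul_dotProduct,
      dotProduct_smul, smul_eq_mul, dotProduct_comm w n, hn]
    ring
  have p1 : 0 ≤ (u + (24 : ℝ) • x) ⬝ᵥ (u + (24 : ℝ) • x) :=
    Finset.sum_nonneg fun i _ => mul_self_nonneg _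
  have p2 : 0 ≤ (w - (24 : ℝ) • n) ⬝ᵥ (w - (24 : ℝ) • n) :=
    Finset.sum_nonneg fun i _ => mul_self_nonneg _
  constructor
  · have : (u + (24 : ℝ) • x) ⬝ᵥ (u + (24 : ℝ) • x) = 0 := by linarith
    rw [eq_neg_of_add_eq_zero_left (dotProduct_self_eq_zero.mp this), neg_smul]
  · have : (w - (24 : ℝ) • n) ⬝ᵥ (w - (24 : ℝ) • n) = 0 := by linarith
    exact sub_eq_zero.mp (dotProduct_self_eq_zero.mp this)

variable [DecidableEq ι]

/-- The coefficients of t, t², t³ in `hessian_identity` at x + tn, applied to v. By `normal_mulVec`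
the gradient there is a combination of x and n, so only Q(x, x), Q(x, n) and Q(n, n) appear. -/
theorem hessian_coeffs {v : ι → ℝ} (hv : quarticMatrix F x x *ᵥ v = (8 : ℝ) • v)
    (hnv : n ⬝ᵥ v = 0) :
    quarticMatrix F x x *ᵥ quarticMatrix F x n *ᵥ v = (8 : ℝ) • (quarticMatrix F x n *ᵥ v) ∧
    quarticMatrix F x x *ᵥ quarticMatrix F n n *ᵥ v - (40 : ℝ) • (quarticMatrix F n n *ᵥ v) +
      (4 : ℝ) • (quarticMatrix F x n *ᵥ quarticMatrix F x n *ᵥ v) = (768 : ℝ) • v ∧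
    quarticMatrix F x n *ᵥ quarticMatrix F n n *ᵥ v +
      quarticMatrix F n n *ᵥ quarticMatrix F x n *ᵥ v = (16 : ℝ) • (quarticMatrix F x n *ᵥ v) := by
  have hxn : x ⬝ᵥ n = 0 := h.dot_eq_zero (by norm_num) hn'
  have hxv : x ⬝ᵥ v = 0 := h.dot_eq_zero (by norm_num) hv
  obtain ⟨hRx, hRn⟩ := h.normal_mulVec hn hn'
  have key : ∀ t : ℝ, ∀ i, 0 + t * (2 * ((quarticMatrix F x x *ᵥ quarticMatrix F x n *ᵥ v) i -
        8 * (quarticMatrix F x n *ᵥ v) i)) +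
      t ^ 2 * ((quarticMatrix F x x *ᵥ quarticMatrix F n n *ᵥ v) i -
        40 * (quarticMatrix F n n *ᵥ v) i +
        4 * (quarticMatrix F x n *ᵥ quarticMatrix F x n *ᵥ v) i - 768 * v i) +
      t ^ 3 * (2 * ((quarticMatrix F x n *ᵥ quarticMatrix F n n *ᵥ v) i +
        (quarticMatrix F n n *ᵥ quarticMatrix F x n *ᵥ v) i - 16 * (quarticMatrix F x n *ᵥ v) i)) +
      t ^ 4 * ((quarticMatrix F n n *ᵥ quarticMatrix F n n *ᵥ v) i +
        16 * (quarticMatrix F n n *ᵥ v) i - 192 * v i) = 0 := by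
    intro t i
    have h1 := hessian_identity h.homogeneous h.gradient_sq (x + t • n)
    have hg : gradVec F (x + t • n) = (4 - 12 * t ^ 2) • x + (4 * t ^ 3 - 12 * t) • n := by
      have h6 := h.six_smul_gradVec_add_smul hn' t
      rw [hRx, hRn] at h6
      have : gradVec F (x + t • n) = (6⁻¹ : ℝ) • ((6 : ℝ) • gradVec F (x + t • n)) := by
        rw [smul_smul]; norm_num
      rw [this, h6]
      module
    rw [hg] at h1
    have h2 := congrFun (congrArg (fun M => M *ᵥ v) h1) i
    simp only [quarticMatrix_add_left, quarticMatrix_add_right, quarticMatrix_smul_left,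
      quarticMatrix_smul_right, add_mulVec, smul_mulVec, ← mulVec_mulVec, mulVec_add, mulVec_smul,
      vecMulVec_mulVec, add_dotProduct, dotProduct_add, smul_dotProduct, dotProduct_smul, hnv, hxv,
      hxn, dotProduct_comm n x, hn, h.dot_self, quarticMatrix_comm F n x, hv, one_mulVec, smul_zero,
      mul_zero, add_zero, Pi.add_apply, Pi.smul_apply, smul_eq_mul, MulOpposite.op_zero, zero_smul] at h2
    linear_combination h2
  have key' := fun i => quartic_coeffs_eq_zero fun t => key t i
  refine ⟨?_, ?_, ?_⟩
  · ext i
    have := (key' i).1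
    simp only [Pi.smul_apply, smul_eq_mul]
    linarith
  · ext i
    have := (key' i).2.1
    simp only [Pi.smul_apply, Pi.add_apply, Pi.sub_apply, smul_eq_mul]
    linarith
  · ext i
    have := (key' i).2.2
    simp only [Pi.smul_apply, Pi.add_apply, smul_eq_mul]
    linarith

theorem mulVec_mem {v : ι → ℝ} (hv : quarticMatrix F x x *ᵥ v = (8 : ℝ) • v) :
    quarticMatrix F x x *ᵥ quarticMatrix F x n *ᵥ v = (8 : ℝ) • (quarticMatrix F x n *ᵥ v) :=
  (h.hessian_coeffs hn hn' hv (dotProduct_eq_zero_of_quarticMatrix_mulVec hn' hv)).1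

/-- Applying Q(x, x) to the t² relation and reducing its square by `sq_eq` gives a second linear
equation, and Q(x, x)Q(n, n)v is eliminated between the two. -/
theorem normal_mulVec_eigenvector {v : ι → ℝ} (hv : quarticMatrix F x x *ᵥ v = (8 : ℝ) • v) :
    (8 : ℝ) • (quarticMatrix F n n *ᵥ v) =
      quarticMatrix F x n *ᵥ quarticMatrix F x n *ᵥ v - (192 : ℝ) • v := by
  have e2 := (h.hessian_coeffs hn hn' hv (dotProduct_eq_zero_of_quarticMatrix_mulVec hn' hv)).2.1
  have hC := h.mulVec_mem hn hn' (h.mulVec_mem hn hn' hv)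
  have hxv : x ⬝ᵥ v = 0 := h.dot_eq_zero (by norm_num) hv
  have hxR : x ⬝ᵥ quarticMatrix F n n *ᵥ v = 0 := by
    rw [dotProduct_quarticMatrix_mulVec, (h.normal_mulVec hn hn').1, smul_dotProduct, hxv,
      smul_zero]
  have e3 := congrArg (fun u => quarticMatrix F x x *ᵥ u) e2
  simp only [mulVec_add, mulVec_sub, mulVec_smul, hC, hv] at e3
  rw [mulVec_mulVec, h.sq_eq] at e3
  simp only [add_mulVec, sub_mulVec, smul_mulVec, one_mulVec, vecMulVec_mulVec, hxR,
    MulOpposite.op_zero, zero_smul, smul_zero, add_zero] at e3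
  ext i
  have a2 := congrFun e2 i
  have a3 := congrFun e3 i
  simp only [Pi.smul_apply, Pi.add_apply, Pi.sub_apply, smul_eq_mul] at a2 a3 ⊢
  linarith

/-- Substituting the formula for Q(n, n) on tangent vectors into the t³ relation leaves an equation
in Q(x, n) alone. -/
theorem cube_mulVec {v : ι → ℝ} (hv : quarticMatrix F x x *ᵥ v = (8 : ℝ) • v) :
    quarticMatrix F x n *ᵥ quarticMatrix F x n *ᵥ quarticMatrix F x n *ᵥ v =
      (256 : ℝ) • (quarticMatrix F x n *ᵥ v) := by
  have e3 := (h.hessian_coeffs hn hn' hv (dotProduct_eq_zero_of_quarticMatrix_mulVec hn' hv)).2.2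
  have r1 := h.normal_mulVec_eigenvector hn hn' (h.mulVec_mem hn hn' hv)
  have r2 := congrArg (fun u => quarticMatrix F x n *ᵥ u) (h.normal_mulVec_eigenvector hn hn' hv)
  simp only [mulVec_smul, mulVec_sub] at r2
  ext i
  have a1 := congrFun r1 i
  have a2 := congrFun r2 i
  have a3 := congrFun e3 i
  simp only [Pi.smul_apply, Pi.add_apply, Pi.sub_apply, smul_eq_mul] at a1 a2 a3 ⊢
  linarith

end IsFocalPoint

end NormalDirections

/-! ### Curves, tangent space and shape operators of the focal manifold -/

section ShapeOperators

open MvPolynomial Matrix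

theorem MvPolynomial.hasDerivAt_eval_comp {ι : Type*} [Fintype ι] (p : MvPolynomial ι ℝ)
    {γ : ℝ → ι → ℝ} {γ' : ι → ℝ} {t : ℝ} (hγ : ∀ i, HasDerivAt (fun s => γ s i) (γ' i) t) :
    HasDerivAt (fun s => eval (γ s) p) (∑ i, γ' i * eval (γ t) (pderiv i p)) t := by
  classical
  induction p using MvPolynomial.induction_on with
  | C a => simpa using hasDerivAt_const t a
  | add p q hp hq =>
    simpa only [map_add, mul_add, Finset.sum_add_distrib] using hp.fun_add hq
  | mul_X p i hp =>
    simp only [map_mul, eval_X]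
    refine (hp.fun_mul (hγ i)).congr_deriv (Eq.symm ?_)
    simp only [Derivation.leibniz, pderiv_X, smul_eq_mul, map_add, map_mul, eval_X, mul_add,
      Finset.sum_add_distrib, Finset.sum_mul]
    rw [Finset.sum_eq_single i]
    · rw [add_comm]
      simp only [Pi.single_eq_same, map_one]
      congr 1
      · exact Finset.sum_congr rfl fun j _ => by ring
      · ring
    · intro b _ hb
      simp [Pi.single_eq_of_ne' hb]
    · simp

section Curves

variable {mp mm : ℕ} {F : MvPolynomial (Fin (2 * (mp + mm) + 2)) ℝ} {x : Ambient mp mm}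

theorem EuclideanSpace.inner_eq_dotProduct {ι : Type*} [Fintype ι] (u v : EuclideanSpace ℝ ι) :
    ⟪u, v⟫ = WithLp.ofLp u ⬝ᵥ WithLp.ofLp v := by
  rw [EuclideanSpace.inner_eq_star_dotProduct, star_trivial, dotProduct_comm]

theorem isFocalPoint_of_mem (hF : IsCartanMunzner mp mm F) (hx : x ∈ focalPlus F) :
    IsFocalPoint F (WithLp.ofLp x) where
  homogeneous := hF.homogeneous
  gradient_sq := hF.gradient_sq
  dot_self := by
    rw [← EuclideanSpace.inner_eq_dotProduct, real_inner_self_eq_norm_sq, hx.1, one_pow]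
  eval_eq := hx.2

theorem hasDerivAt_ofLp_apply {ι : Type*} [Fintype ι] {γ : ℝ → EuclideanSpace ℝ ι}
    (hγ : ContDiff ℝ ∞ γ) (s : ℝ) (i : ι) :
    HasDerivAt (fun s => WithLp.ofLp (γ s) i) (WithLp.ofLp (deriv γ s) i) s := by
  have h1 : HasDerivAt γ (deriv γ s) s :=
    (hγ.differentiable (by simp) s).hasDerivAt
  exact (EuclideanSpace.proj (𝕜 := ℝ) i).hasFDerivAt.comp_hasDerivAt s h1

variable {γ : ℝ → Ambient mp mm}

/-- Derivative of ∇F(γ) = 4γ, which holds along any curve in the focal manifold. -/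
theorem sum_deriv_mul_hessian (hF : IsCartanMunzner mp mm F)
    (hγ : IsSmoothCurveAt (focalPlus F) x γ) (s : ℝ) (i : Fin (2 * (mp + mm) + 2)) :
    ∑ j, WithLp.ofLp (deriv γ s) j * eval (WithLp.ofLp (γ s)) (pderiv j (pderiv i F)) =
      4 * WithLp.ofLp (deriv γ s) i := by
  have h1 := hasDerivAt_eval_comp (pderiv i F) (hasDerivAt_ofLp_apply hγ.smooth s)
  have h2 := (hasDerivAt_ofLp_apply hγ.smooth s i).const_mul 4
  have h3 : (fun s => eval (WithLp.ofLp (γ s)) (pderiv i F)) =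
      fun s => 4 * WithLp.ofLp (γ s) i := by
    funext u
    exact congrFun (isFocalPoint_of_mem hF (hγ.mem u)).gradVec_eq i
  rw [h3] at h1
  exact h1.unique h2

theorem quarticMatrix_mulVec_deriv (hF : IsCartanMunzner mp mm F)
    (hγ : IsSmoothCurveAt (focalPlus F) x γ) :
    quarticMatrix F (WithLp.ofLp x) (WithLp.ofLp x) *ᵥ WithLp.ofLp (deriv γ 0) =
      (8 : ℝ) • WithLp.ofLp (deriv γ 0) := by
  ext i
  have h := sum_deriv_mul_hessian hF hγ 0 i
  rw [hγ.start] at h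
  simp only [mulVec, dotProduct, quarticMatrix_self_apply hF.homogeneous, Pi.smul_apply,
    smul_eq_mul]
  rw [show (8 : ℝ) * WithLp.ofLp (deriv γ 0) i = 2 * (4 * WithLp.ofLp (deriv γ 0) i) by ring, ← h,
    Finset.mul_sum]
  exact Finset.sum_congr rfl fun j _ => by ring

theorem quarticMatrix_mulVec_deriv_deriv (hF : IsCartanMunzner mp mm F)
    (hγ : IsSmoothCurveAt (focalPlus F) x γ) :
    quarticMatrix F (WithLp.ofLp x) (WithLp.ofLp x) *ᵥ WithLp.ofLp (deriv (deriv γ) 0) +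
      (2 : ℝ) • (quarticMatrix F (WithLp.ofLp x) (WithLp.ofLp (deriv γ 0)) *ᵥ
        WithLp.ofLp (deriv γ 0)) = (8 : ℝ) • WithLp.ofLp (deriv (deriv γ) 0) := by
  ext i
  have hd : ContDiff ℝ ∞ (deriv γ) := (contDiff_infty_iff_deriv.mp hγ.smooth).2
  have h1 : HasDerivAt (fun s => ∑ j, WithLp.ofLp (deriv γ s) j *
      eval (WithLp.ofLp (γ s)) (pderiv j (pderiv i F))) _ 0 :=
    HasDerivAt.fun_sum fun j _ => (hasDerivAt_ofLp_apply hd 0 j).mul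
      (hasDerivAt_eval_comp (pderiv j (pderiv i F)) (hasDerivAt_ofLp_apply hγ.smooth 0))
  have h2 := (hasDerivAt_ofLp_apply hd 0 i).const_mul 4
  simp only [sum_deriv_mul_hessian hF hγ] at h1
  have h3 := h1.unique h2
  simp only [sum_eval_third_partial hF.homogeneous, Finset.sum_add_distrib, hγ.start] at h3
  rw [quarticMatrix_comm F (WithLp.ofLp x) (WithLp.ofLp (deriv γ 0))]
  simp only [mulVec, dotProduct, quarticMatrix_self_apply hF.homogeneous, Pi.add_apply,
    Pi.smul_apply, smul_eq_mul]
  rw [show (8 : ℝ) * WithLp.ofLp (deriv (deriv γ) 0) i =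
    2 * (4 * WithLp.ofLp (deriv (deriv γ) 0) i) by ring, ← h3, mul_add (2 : ℝ), Finset.mul_sum,
    Finset.mul_sum, Finset.mul_sum]
  congr 1
  · exact Finset.sum_congr rfl fun j _ => by ring
  · exact Finset.sum_congr rfl fun j _ => by ring

/-- Pairing the twice differentiated relation ∇F(γ) = 4γ with n: the eigenvalues 8 and -24 differ by
32, and half of this is the 16. -/
theorem inner_deriv_deriv_eq (hF : IsCartanMunzner mp mm F)
    (hγ : IsSmoothCurveAt (focalPlus F) x γ) {n : Ambient mp mm}
    (hn : quarticMatrix F (WithLp.ofLp x) (WithLp.ofLp x) *ᵥ WithLp.ofLp n =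
      (-24 : ℝ) • WithLp.ofLp n) :
    16 * ⟪deriv (deriv γ) 0, n⟫ = WithLp.ofLp (deriv γ 0) ⬝ᵥ
      quarticMatrix F (WithLp.ofLp x) (WithLp.ofLp n) *ᵥ WithLp.ofLp (deriv γ 0) := by
  have h1 := congrArg (fun u => WithLp.ofLp n ⬝ᵥ u) (quarticMatrix_mulVec_deriv_deriv hF hγ)
  simp only [dotProduct_add, dotProduct_smul, smul_eq_mul] at h1
  rw [dotProduct_quarticMatrix_mulVec, hn, dotProduct_quarticMatrix_mulVec,
    quarticMatrix_mulVec_comm, smul_dotProduct, smul_eq_mul] at h1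
  rw [EuclideanSpace.inner_eq_dotProduct, dotProduct_comm, dotProduct_quarticMatrix_mulVec]
  linarith

end Curves

section Tangent

variable {mp mm : ℕ} {F : MvPolynomial (Fin (2 * (mp + mm) + 2)) ℝ} {x : Ambient mp mm}
  {T : Submodule ℝ (Ambient mp mm)}

theorem IsTangentSpace.mulVec_eq (hF : IsCartanMunzner mp mm F)
    (hT : IsTangentSpace (focalPlus F) x T) {v : Ambient mp mm} (hv : v ∈ T) :
    quarticMatrix F (WithLp.ofLp x) (WithLp.ofLp x) *ᵥ WithLp.ofLp v =
      (8 : ℝ) • WithLp.ofLp v := by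
  have : v ∈ tangentVectors (focalPlus F) x := hT ▸ hv
  obtain ⟨γ, hγ, rfl⟩ := this
  exact quarticMatrix_mulVec_deriv hF hγ

/-- The orthogonal projection onto the tangent space of the focal manifold. -/
noncomputable def tangentProjection (F : MvPolynomial (Fin (2 * (mp + mm) + 2)) ℝ)
    (x : Fin (2 * (mp + mm) + 2) → ℝ) :
    Matrix (Fin (2 * (mp + mm) + 2)) (Fin (2 * (mp + mm) + 2)) ℝ :=
  (32⁻¹ : ℝ) • (quarticMatrix F x x + (24 : ℝ) • 1 - (48 : ℝ) • vecMulVec x x)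

/-- The coefficients of `tangentProjection` are chosen so that the eigenvalues 8, -24 and the
eigenvalue 24 on x become 1, 0 and 0. -/
theorem IsFocalPoint.tangentProjection_mulVec {x v : Fin (2 * (mp + mm) + 2) → ℝ}
    (h : IsFocalPoint F x) (hv : quarticMatrix F x x *ᵥ v = (8 : ℝ) • v) :
    tangentProjection F x *ᵥ v = v := by
  simp only [tangentProjection, smul_mulVec, sub_mulVec, add_mulVec, hv, one_mulVec,
    vecMulVec_mulVec, h.dot_eq_zero (by norm_num) hv, MulOpposite.op_zero, zero_smul, smul_zero]
  module

theorem IsFocalPoint.quarticMatrix_mulVec_tangentProjection {x : Fin (2 * (mp + mm) + 2) → ℝ}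
    (h : IsFocalPoint F x) (v : Fin (2 * (mp + mm) + 2) → ℝ) :
    quarticMatrix F x x *ᵥ tangentProjection F x *ᵥ v =
      (8 : ℝ) • (tangentProjection F x *ᵥ v) := by
  simp only [tangentProjection, smul_mulVec, sub_mulVec, add_mulVec, one_mulVec,
    vecMulVec_mulVec, op_smul_eq_smul, mulVec_smul, mulVec_sub, mulVec_add, h.mulVec_self]
  rw [mulVec_mulVec, h.sq_eq]
  simp only [add_mulVec, sub_mulVec, smul_mulVec, one_mulVec, vecMulVec_mulVec, op_smul_eq_smul]
  module

theorem IsFocalPoint.tangentProjection_isProj {x : Fin (2 * (mp + mm) + 2) → ℝ}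
    (h : IsFocalPoint F x) :
    LinearMap.IsProj (LinearMap.range (toLin' (tangentProjection F x)))
      (toLin' (tangentProjection F x)) where
  map_mem v := LinearMap.mem_range_self _ v
  map_id := by
    rintro _ ⟨v, rfl⟩
    simp only [toLin'_apply]
    exact h.tangentProjection_mulVec (h.quarticMatrix_mulVec_tangentProjection v)

theorem trace_quarticMatrix (hF : IsCartanMunzner mp mm F) {x : Fin (2 * (mp + mm) + 2) → ℝ}
    (h : x ⬝ᵥ x = 1) : (quarticMatrix F x x).trace = 16 * ((mm : ℝ) - mp) := by
  have h1 := congrArg (eval x) hF.laplacian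
  simp only [map_sum, map_mul, map_pow, eval_C, eval_X] at h1
  simp only [dotProduct, ← pow_two] at h
  rw [h] at h1
  simp only [trace, diag_apply, quarticMatrix_self_apply hF.homogeneous, ← Finset.mul_sum, h1]
  ring

theorem trace_tangentProjection (hF : IsCartanMunzner mp mm F)
    {x : Fin (2 * (mp + mm) + 2) → ℝ} (h : x ⬝ᵥ x = 1) :
    (tangentProjection F x).trace = 2 * mm + mp := by
  rw [tangentProjection, trace_smul, trace_sub, trace_add, trace_smul, trace_smul,
    trace_quarticMatrix hF h, trace_one, trace_vecMulVec, h]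
  simp only [Fintype.card_fin, smul_eq_mul]
  push_cast
  ring

/-- Velocities lie in the 8-eigenspace, whose dimension is the trace of its projection. Equality of
dimensions makes every 8-eigenvector a velocity, so no curves have to be constructed. -/
theorem IsTangentSpace.mem_of_mulVec_eq (hF : IsCartanMunzner mp mm F) (hx : x ∈ focalPlus F)
    (hT : IsTangentSpace (focalPlus F) x T) (hdim : Module.finrank ℝ T = 2 * mm + mp)
    {v : Ambient mp mm} (hv : quarticMatrix F (WithLp.ofLp x) (WithLp.ofLp x) *ᵥ WithLp.ofLp v =
      (8 : ℝ) • WithLp.ofLp v) : v ∈ T := by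
  have h := isFocalPoint_of_mem hF hx
  set L := WithLp.linearEquiv 2 ℝ (Fin (2 * (mp + mm) + 2) → ℝ) with hL
  set q := toLin' (tangentProjection F (WithLp.ofLp x)) with hq
  have h1 : (Module.finrank ℝ (LinearMap.range q) : ℝ) = 2 * mm + mp := by
    rw [← h.tangentProjection_isProj.trace, trace_toLin'_eq, trace_tangentProjection hF h.dot_self]
  have h2 : Module.finrank ℝ (LinearMap.range q) = 2 * mm + mp := by exact_mod_cast h1
  have h3 : T.map (L : _ →ₗ[ℝ] _) ≤ LinearMap.range q := by
    rintro _ ⟨w, hw, rfl⟩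
    exact ⟨WithLp.ofLp w, h.tangentProjection_mulVec (hT.mulVec_eq hF hw)⟩
  have h4 : T.map (L : _ →ₗ[ℝ] _) = LinearMap.range q := by
    refine Submodule.eq_of_le_of_finrank_eq h3 ?_
    rw [h2, ← hdim]
    exact LinearEquiv.finrank_map_eq L T
  have h5 : L v ∈ T.map (L : _ →ₗ[ℝ] _) := by
    rw [h4]
    exact ⟨WithLp.ofLp v, h.tangentProjection_mulVec hv⟩
  obtain ⟨w, hw, hwv⟩ := h5
  rwa [L.injective hwv] at hw

theorem IsTangentSpace.mulVec_normal (hF : IsCartanMunzner mp mm F) (hx : x ∈ focalPlus F)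
    (hT : IsTangentSpace (focalPlus F) x T) (hdim : Module.finrank ℝ T = 2 * mm + mp)
    {n : Ambient mp mm} (hn : n ∈ normalSpaceInSphere x T) :
    quarticMatrix F (WithLp.ofLp x) (WithLp.ofLp x) *ᵥ WithLp.ofLp n =
      (-24 : ℝ) • WithLp.ofLp n := by
  have h := isFocalPoint_of_mem hF hx
  rw [normalSpaceInSphere, Submodule.mem_orthogonal] at hn
  have hxn : WithLp.ofLp x ⬝ᵥ WithLp.ofLp n = 0 := by
    rw [← EuclideanSpace.inner_eq_dotProduct]
    exact hn x (Submodule.mem_sup_right (Submodule.mem_span_singleton_self x))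
  set w := tangentProjection F (WithLp.ofLp x) *ᵥ WithLp.ofLp n with hw
  have hw8 := h.quarticMatrix_mulVec_tangentProjection (WithLp.ofLp n)
  have hwT : WithLp.toLp 2 w ∈ T := hT.mem_of_mulVec_eq hF hx hdim hw8
  have hwn : w ⬝ᵥ WithLp.ofLp n = 0 := by
    have := hn _ (Submodule.mem_sup_left hwT)
    rwa [EuclideanSpace.inner_eq_dotProduct] at this
  have hwx : WithLp.ofLp x ⬝ᵥ w = 0 := h.dot_eq_zero (by norm_num) hw8
  have hwe : w = (32⁻¹ : ℝ) • (quarticMatrix F (WithLp.ofLp x) (WithLp.ofLp x) *ᵥ WithLp.ofLp n +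
      (24 : ℝ) • WithLp.ofLp n) := by
    simp only [hw, tangentProjection, smul_mulVec, sub_mulVec, add_mulVec, one_mulVec,
      vecMulVec_mulVec, hxn, MulOpposite.op_zero, zero_smul, smul_zero, sub_zero]
  -- The tangential part w of n is orthogonal to n, and w·Q(x, x)n = 8 w·n by symmetry.
  have hww : w ⬝ᵥ w = 0 := by
    nth_rewrite 2 [hwe]
    rw [dotProduct_smul, dotProduct_add, dotProduct_quarticMatrix_mulVec, hw8, dotProduct_smul,
      smul_dotProduct, hwn]
    simp
  rw [dotProduct_self_eq_zero.mp hww] at hwe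
  have h6 := (smul_eq_zero.mp hwe.symm).resolve_left (by norm_num)
  rw [eq_neg_of_add_eq_zero_left h6, neg_smul]

variable (hF : IsCartanMunzner mp mm F) (hx : x ∈ focalPlus F)
  (hT : IsTangentSpace (focalPlus F) x T) (hdim : Module.finrank ℝ T = 2 * mm + mp)
  {n : Ambient mp mm} (hn : n ∈ normalSpaceInSphere x T) (hn1 : ‖n‖ = 1) {S : T →ₗ[ℝ] T}
  (hS : IsShapeOperator (focalPlus F) x T n S)

include hF hx hT hdim hn hn1 hS

/-- Both sides are symmetric and have the same quadratic form, since velocities fill T; polarization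
does the rest. In particular the shape operator is unique. -/
theorem IsShapeOperator.apply_eq (v : T) :
    WithLp.ofLp (S v : Ambient mp mm) = (16⁻¹ : ℝ) •
      (quarticMatrix F (WithLp.ofLp x) (WithLp.ofLp n) *ᵥ WithLp.ofLp (v : Ambient mp mm)) := by
  have h := isFocalPoint_of_mem hF hx
  have hn' := hT.mulVec_normal hF hx hdim hn
  have hnn : WithLp.ofLp n ⬝ᵥ WithLp.ofLp n = 1 := by
    rw [← EuclideanSpace.inner_eq_dotProduct, real_inner_self_eq_norm_sq, hn1, one_pow]
  set Cn := quarticMatrix F (WithLp.ofLp x) (WithLp.ofLp n) with hC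
  have quad : ∀ u : T, 16 * ⟪S u, u⟫ = WithLp.ofLp (u : Ambient mp mm) ⬝ᵥ
      Cn *ᵥ WithLp.ofLp (u : Ambient mp mm) := by
    intro u
    have hu : (u : Ambient mp mm) ∈ tangentVectors (focalPlus F) x := hT ▸ u.2
    obtain ⟨γ, hγ, hγu⟩ := hu
    rw [hS.normal_curvature γ hγ u hγu, inner_deriv_deriv_eq hF hγ hn', hγu]
  have bil : ∀ u w : T, 16 * ⟪S u, w⟫ = WithLp.ofLp (w : Ambient mp mm) ⬝ᵥ
      Cn *ᵥ WithLp.ofLp (u : Ambient mp mm) := by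
    intro u w
    have h1 := quad (u + w)
    have h2 := quad u
    have h3 := quad w
    have h4 : ⟪S w, u⟫ = ⟪S u, w⟫ := by rw [hS.symmetric w u, real_inner_comm]
    have h5 : WithLp.ofLp (u : Ambient mp mm) ⬝ᵥ Cn *ᵥ WithLp.ofLp (w : Ambient mp mm) =
        WithLp.ofLp (w : Ambient mp mm) ⬝ᵥ Cn *ᵥ WithLp.ofLp (u : Ambient mp mm) := by
      rw [hC, dotProduct_quarticMatrix_mulVec, dotProduct_comm]
    simp only [map_add, inner_add_left, inner_add_right, Submodule.coe_add, WithLp.ofLp_add,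
      mulVec_add, add_dotProduct, dotProduct_add, h4, h5] at h1
    linarith
  have hmem : WithLp.toLp 2 ((16⁻¹ : ℝ) • (Cn *ᵥ WithLp.ofLp (v : Ambient mp mm))) ∈ T := by
    refine hT.mem_of_mulVec_eq hF hx hdim ?_
    rw [mulVec_smul, h.mulVec_mem hnn hn' (hT.mulVec_eq hF v.2), smul_comm]
  have heq : S v = ⟨_, hmem⟩ := by
    refine ext_inner_right ℝ fun w => ?_
    have h1 := bil v w
    rw [Submodule.coe_inner T ⟨_, hmem⟩ w, EuclideanSpace.inner_eq_dotProduct,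
      smul_dotProduct, dotProduct_comm, ← h1]
    simp
  rw [heq]

theorem IsShapeOperator.cube : S ∘ₗ S ∘ₗ S = S := by
  have h := isFocalPoint_of_mem hF hx
  have hn' := hT.mulVec_normal hF hx hdim hn
  have hnn : WithLp.ofLp n ⬝ᵥ WithLp.ofLp n = 1 := by
    rw [← EuclideanSpace.inner_eq_dotProduct, real_inner_self_eq_norm_sq, hn1, one_pow]
  ext1 v
  apply Subtype.ext
  apply WithLp.ofLp_injective 2
  simp only [LinearMap.comp_apply]
  rw [hS.apply_eq hF hx hT hdim hn hn1, hS.apply_eq hF hx hT hdim hn hn1,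
    hS.apply_eq hF hx hT hdim hn hn1, mulVec_smul, mulVec_smul, mulVec_smul,
    h.cube_mulVec hnn hn' (hT.mulVec_eq hF v.2)]
  module

end Tangent

end ShapeOperators

/-! ### Polarization of the cubic identity -/

section CubicIdentity

variable {R : Type*} [Ring R] [Algebra ℝ R] {m : ℕ} {X : Fin m → R}

/-- The generic element `S = ∑ cₐ Xₐ` satisfies `S ^ 3 = |c|² S`. -/
def IsTripotentFamily (X : Fin m → R) : Prop :=
  ∀ c : Fin m → ℝ, (∑ a, c a • X a) ^ 3 = (∑ a, c a ^ 2) • ∑ a, c a • X a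

namespace IsTripotentFamily

variable (h : IsTripotentFamily X)
include h

theorem pow_three (a : Fin m) : X a ^ 3 = X a := by
  simpa [Pi.single_apply] using h (Pi.single a 1)

theorem cube_add_smul {a b : Fin m} (hab : a ≠ b) (t : ℝ) :
    (X a + t • X b) ^ 3 = (1 + t ^ 2) • (X a + t • X b) := by
  have h1 := h (Pi.single a 1 + Pi.single b t)
  have e1 : ∑ i, (Pi.single a 1 + Pi.single b t : Fin m → ℝ) i • X i = X a + t • X b := by
    simp [Pi.single_apply, add_smul, Finset.sum_add_distrib]
  have e2 : ∑ i, (Pi.single a 1 + Pi.single b t : Fin m → ℝ) i ^ 2 = 1 + t ^ 2 := by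
    have : ∀ i, (Pi.single a 1 + Pi.single b t : Fin m → ℝ) i ^ 2 =
        (Pi.single a 1 : Fin m → ℝ) i + (Pi.single b (t ^ 2) : Fin m → ℝ) i := by
      intro i
      simp only [Pi.add_apply, Pi.single_apply]
      split_ifs <;> simp_all
    rw [Finset.sum_congr rfl fun i _ => this i]
    simp [Finset.sum_add_distrib]
  rwa [e1, e2] at h1

/-- The part of (X_a + tX_b)³ odd in t, taken at t = ±1, after removing X_b³ = X_b. -/
theorem polarize₂ {a b : Fin m} (hab : a ≠ b) :
    X a * X a * X b + X a * X b * X a + X b * X a * X a = X b := by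
  have h1 := h.cube_add_smul hab 1
  have h2 := h.cube_add_smul hab (-1)
  have h3 := h.pow_three b
  have e : (2 : ℝ) • (X a * X a * X b + X a * X b * X a + X b * X a * X a) =
      (X a + (1 : ℝ) • X b) ^ 3 - (X a + (-1 : ℝ) • X b) ^ 3 - (2 : ℝ) • X b ^ 3 := by
    simp only [one_smul, neg_smul, two_smul]
    noncomm_ring
  rw [h1, h2, h3] at e
  have e' : (2 : ℝ) • (X a * X a * X b + X a * X b * X a + X b * X a * X a) = (2 : ℝ) • X b := by
    rw [e]; module
  exact smul_right_injective R (two_ne_zero (α := ℝ)) e'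

theorem cube_add_smul_add_smul {a b c : Fin m} (hab : a ≠ b) (hac : a ≠ c) (hbc : b ≠ c)
    (s t : ℝ) : (X a + s • X b + t • X c) ^ 3 =
      (1 + s ^ 2 + t ^ 2) • (X a + s • X b + t • X c) := by
  have h1 := h (Pi.single a 1 + Pi.single b s + Pi.single c t)
  have e1 : ∑ i, (Pi.single a 1 + Pi.single b s + Pi.single c t : Fin m → ℝ) i • X i =
      X a + s • X b + t • X c := by
    simp [Pi.single_apply, add_smul, Finset.sum_add_distrib]
  have e2 : ∑ i, (Pi.single a 1 + Pi.single b s + Pi.single c t : Fin m → ℝ) i ^ 2 =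
      1 + s ^ 2 + t ^ 2 := by
    have : ∀ i, (Pi.single a 1 + Pi.single b s + Pi.single c t : Fin m → ℝ) i ^ 2 =
        (Pi.single a 1 : Fin m → ℝ) i + (Pi.single b (s ^ 2) : Fin m → ℝ) i +
          (Pi.single c (t ^ 2) : Fin m → ℝ) i := by
      intro i
      simp only [Pi.add_apply, Pi.single_apply]
      split_ifs <;> simp_all
    rw [Finset.sum_congr rfl fun i _ => this i]
    simp [Finset.sum_add_distrib]
  rwa [e1, e2] at h1

/-- The four sign choices extract the part of the cube linear in each of the three elements; the
right-hand side has no such part. -/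
theorem polarize₃ {a b c : Fin m} (hab : a ≠ b) (hac : a ≠ c) (hbc : b ≠ c) :
    X a * (X b * X c + X c * X b) + (X b * X a * X c + X c * X a * X b) +
      (X b * X c + X c * X b) * X a = 0 := by
  have h1 := h.cube_add_smul_add_smul hab hac hbc 1 1
  have h2 := h.cube_add_smul_add_smul hab hac hbc 1 (-1)
  have h3 := h.cube_add_smul_add_smul hab hac hbc (-1) 1
  have h4 := h.cube_add_smul_add_smul hab hac hbc (-1) (-1)
  have e : (4 : ℝ) • (X a * (X b * X c + X c * X b) + (X b * X a * X c + X c * X a * X b) +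
      (X b * X c + X c * X b) * X a) =
      (X a + (1 : ℝ) • X b + (1 : ℝ) • X c) ^ 3 - (X a + (1 : ℝ) • X b + (-1 : ℝ) • X c) ^ 3 -
      (X a + (-1 : ℝ) • X b + (1 : ℝ) • X c) ^ 3 +
      (X a + (-1 : ℝ) • X b + (-1 : ℝ) • X c) ^ 3 := by
    rw [show (4 : ℝ) = 1 + 1 + 1 + 1 by norm_num]
    simp only [one_smul, neg_smul, add_smul]
    noncomm_ring
  rw [h1, h2, h3, h4] at e
  have e' : (4 : ℝ) • (X a * (X b * X c + X c * X b) + (X b * X a * X c + X c * X a * X b) +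
      (X b * X c + X c * X b) * X a) = (4 : ℝ) • (0 : R) := by
    rw [e]; module
  exact smul_right_injective R (four_ne_zero (α := ℝ)) e'

end IsTripotentFamily

end CubicIdentity

/-! ### Shape matrices and their block algebra -/

section ShapeMatrices

open MvPolynomial Matrix

theorem IsShapeOperator.sum_smul {E : Type*} [NormedAddCommGroup E] [InnerProductSpace ℝ E]
    {M : Set E} {x : E} {T : Submodule ℝ E} {κ : Type*} [Fintype κ] {n : κ → E}
    {S : κ → T →ₗ[ℝ] T} (hS : ∀ a, IsShapeOperator M x T (n a) (S a)) (c : κ → ℝ) :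
    IsShapeOperator M x T (∑ a, c a • n a) (∑ a, c a • S a) where
  symmetric v w := by
    simp only [LinearMap.sum_apply, LinearMap.smul_apply, sum_inner, inner_sum, inner_smul_left,
      inner_smul_right]
    exact Finset.sum_congr rfl fun a _ => by rw [(hS a).symmetric v w]; rfl
  normal_curvature γ hγ v hv := by
    simp only [LinearMap.sum_apply, LinearMap.smul_apply, sum_inner, inner_sum, inner_smul_left,
      inner_smul_right]
    exact Finset.sum_congr rfl fun a _ => by rw [(hS a).normal_curvature γ hγ v hv]; rfl

namespace NormalBasis

variable {mp mm r : ℕ} {F : MvPolynomial (Fin (2 * (mp + mm) + 2)) ℝ} {x : Ambient mp mm}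

section

variable {M : Set (Ambient mp mm)} (D : NormalBasis mp mm r M x)

theorem finrank_tangent (h1 : r ≤ mp) (h2 : r ≤ mm) : Module.finrank ℝ D.T = 2 * mm + mp := by
  rw [Module.finrank_eq_card_basis D.e.toBasis]
  simp only [Fintype.card_sum, Fintype.card_fin]
  omega

theorem S_eq_toMatrix (a : Fin (mp + 1)) :
    D.S a = LinearMap.toMatrix D.e.toBasis D.e.toBasis (D.shape a) := by
  ext i j
  simp [S, LinearMap.toMatrix_apply, OrthonormalBasis.repr_apply_apply]

theorem S_transpose (a : Fin (mp + 1)) : (D.S a)ᵀ = D.S a := by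
  ext i j
  simp only [S, transpose_apply, of_apply]
  rw [← (D.isShapeOperator a).symmetric, real_inner_comm]

theorem sum_smul_mem (c : Fin (mp + 1) → ℝ) : ∑ a, c a • D.n a ∈ normalSpaceInSphere x D.T := by
  rw [← D.span_n]
  exact Submodule.sum_mem _ fun a _ => Submodule.smul_mem _ _ (Submodule.subset_span ⟨a, rfl⟩)

theorem norm_sum_smul_sq (c : Fin (mp + 1) → ℝ) : ‖∑ a, c a • D.n a‖ ^ 2 = ∑ a, c a ^ 2 := by
  rw [← real_inner_self_eq_norm_sq, D.orthonormal_n.inner_sum]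
  simp [pow_two]

end

variable (D : NormalBasis mp mm r (focalPlus F) x)

theorem sum_smul_shape_cube (hF : IsCartanMunzner mp mm F) (hx : x ∈ focalPlus F) (h1 : r ≤ mp)
    (h2 : r ≤ mm) {c : Fin (mp + 1) → ℝ} (hc : ∑ a, c a ^ 2 = 1) :
    (∑ a, c a • D.shape a) ∘ₗ (∑ a, c a • D.shape a) ∘ₗ (∑ a, c a • D.shape a) =
      ∑ a, c a • D.shape a := by
  refine (IsShapeOperator.sum_smul D.isShapeOperator c).cube hF hx D.isTangentSpace
    (D.finrank_tangent h1 h2) (D.sum_smul_mem c) ?_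
  have := D.norm_sum_smul_sq c
  rw [hc] at this
  exact (pow_eq_one_iff_of_nonneg (norm_nonneg _) two_ne_zero).mp this

theorem isTripotentFamily (hF : IsCartanMunzner mp mm F) (hx : x ∈ focalPlus F) (h1 : r ≤ mp)
    (h2 : r ≤ mm) : IsTripotentFamily D.S := by
  have unit : ∀ c : Fin (mp + 1) → ℝ, ∑ a, c a ^ 2 = 1 →
      (∑ a, c a • D.S a) ^ 3 = ∑ a, c a • D.S a := by
    intro c hc
    have e : ∑ a, c a • D.S a =
        LinearMap.toMatrix D.e.toBasis D.e.toBasis (∑ a, c a • D.shape a) := by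
      simp only [map_sum, map_smul, S_eq_toMatrix]
    rw [e, pow_three, ← LinearMap.toMatrix_comp, ← LinearMap.toMatrix_comp,
      D.sum_smul_shape_cube hF hx h1 h2 hc]
  intro c
  rcases eq_or_ne (∑ a, c a ^ 2) 0 with h0 | h0
  · have : ∀ a, c a = 0 := fun a => by
      have := (Finset.sum_eq_zero_iff_of_nonneg fun i _ => sq_nonneg (c i)).mp h0 a
        (Finset.mem_univ a)
      exact pow_eq_zero_iff two_ne_zero |>.mp this
    simp [this]
  -- Both sides are homogeneous of degree three in c, so scaling reduces to unit normals.
  · have hpos : 0 < ∑ a, c a ^ 2 :=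
      lt_of_le_of_ne (Finset.sum_nonneg fun i _ => sq_nonneg (c i)) h0.symm
    set ρ := √(∑ a, c a ^ 2) with hρ
    have hρ2 : ρ ^ 2 = ∑ a, c a ^ 2 := Real.sq_sqrt hpos.le
    have hρ0 : ρ ≠ 0 := (Real.sqrt_pos.mpr hpos).ne'
    have hu := unit (fun a => ρ⁻¹ * c a) (by
      simp only [mul_pow, ← Finset.mul_sum, ← hρ2]
      field_simp)
    simp only [mul_smul, ← Finset.smul_sum, smul_pow] at hu
    have := congrArg (fun M => ρ ^ 3 • M) hu
    simp only [smul_smul] at this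
    rw [← mul_pow, mul_inv_cancel₀ hρ0, one_pow, one_smul] at this
    rw [this, ← hρ2]
    congr 1
    field_simp

end NormalBasis

section Blocks

variable {p q k : Type*}

/-- The symmetric block matrix with vanishing diagonal blocks and upper blocks `A`, `B`, `C`. -/
def hollowBlocks (A : Matrix p q ℝ) (B : Matrix p k ℝ) (C : Matrix q k ℝ) :
    Matrix (p ⊕ (q ⊕ k)) (p ⊕ (q ⊕ k)) ℝ :=
  fromBlocks 0 (fromCols A B) (fromRows Aᵀ Bᵀ) (fromBlocks 0 C Cᵀ 0)

/-- The block diagonal matrix `diag(1, -1, 0)`. -/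
def signBlocks (p q k : Type*) [DecidableEq p] [DecidableEq q] :
    Matrix (p ⊕ (q ⊕ k)) (p ⊕ (q ⊕ k)) ℝ :=
  fromBlocks 1 (fromCols 0 0) (fromRows 0 0) (fromBlocks (-1) 0 0 0)

theorem diagonal_eq_signBlocks [DecidableEq p] [DecidableEq q] [DecidableEq k] :
    diagonal (Sum.elim (fun _ => 1) (Sum.elim (fun _ => -1) fun _ => 0)) = signBlocks p q k := by
  ext (i | i | i) (j | j | j) <;> simp [signBlocks, diagonal_apply, one_apply]
  split_ifs <;> simp

variable [Fintype p] [Fintype q] [Fintype k]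
variable (A A' A'' : Matrix p q ℝ) (B B' B'' : Matrix p k ℝ) (C C' C'' : Matrix q k ℝ)

theorem hollowBlocks_mul : hollowBlocks A B C * hollowBlocks A' B' C' =
    fromBlocks (A * A'ᵀ + B * B'ᵀ) (fromCols (B * C'ᵀ) (A * C')) (fromRows (C * B'ᵀ) (Cᵀ * A'ᵀ))
      (fromBlocks (Aᵀ * A' + C * C'ᵀ) (Aᵀ * B') (Bᵀ * A') (Bᵀ * B' + Cᵀ * C')) := by
  ext (i | i | i) (j | j | j) <;>
  simp [hollowBlocks, mul_apply, Fintype.sum_sum_type]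

theorem hollowBlocks_mul_mul_toBlocks₁₁ :
    (hollowBlocks A B C * hollowBlocks A' B' C' * hollowBlocks A'' B'' C'').toBlocks₁₁ =
      B * C'ᵀ * A''ᵀ + A * C' * B''ᵀ := by
  rw [hollowBlocks_mul, hollowBlocks, fromBlocks_multiply, toBlocks_fromBlocks₁₁,
    fromCols_mul_fromRows, Matrix.mul_zero, zero_add]

variable [DecidableEq p] [DecidableEq q]

theorem signBlocks_mul (X : Matrix p p ℝ) (X₁₂ : Matrix p q ℝ) (X₁₃ : Matrix p k ℝ)
    (X₂₁ : Matrix q p ℝ) (X₃₁ : Matrix k p ℝ) (X₂₂ : Matrix q q ℝ) (X₂₃ : Matrix q k ℝ)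
    (X₃₂ : Matrix k q ℝ) (X₃₃ : Matrix k k ℝ) : signBlocks p q k *
      fromBlocks X (fromCols X₁₂ X₁₃) (fromRows X₂₁ X₃₁) (fromBlocks X₂₂ X₂₃ X₃₂ X₃₃) =
    fromBlocks X (fromCols X₁₂ X₁₃) (fromRows (-X₂₁) 0) (fromBlocks (-X₂₂) (-X₂₃) 0 0) := by
  ext (i | i | i) (j | j | j) <;>
  simp [signBlocks, mul_apply, Fintype.sum_sum_type, one_apply]

theorem mul_signBlocks (X : Matrix p p ℝ) (X₁₂ : Matrix p q ℝ) (X₁₃ : Matrix p k ℝ)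
    (X₂₁ : Matrix q p ℝ) (X₃₁ : Matrix k p ℝ) (X₂₂ : Matrix q q ℝ) (X₂₃ : Matrix q k ℝ)
    (X₃₂ : Matrix k q ℝ) (X₃₃ : Matrix k k ℝ) :
      fromBlocks X (fromCols X₁₂ X₁₃) (fromRows X₂₁ X₃₁) (fromBlocks X₂₂ X₂₃ X₃₂ X₃₃) *
      signBlocks p q k =
    fromBlocks X (fromCols (-X₁₂) 0) (fromRows X₂₁ X₃₁) (fromBlocks (-X₂₂) 0 (-X₃₂) 0) := by
  ext (i | i | i) (j | j | j) <;>
  simp [signBlocks, mul_apply, Fintype.sum_sum_type, one_apply]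

theorem hollowBlocks_mul_signBlocks_mul :
    hollowBlocks A B C * signBlocks p q k * hollowBlocks A' B' C' =
    fromBlocks (-(A * A'ᵀ)) (fromCols 0 (-(A * C'))) (fromRows 0 (-(Cᵀ * A'ᵀ)))
      (fromBlocks (Aᵀ * A') (Aᵀ * B') (Bᵀ * A') (Bᵀ * B' - Cᵀ * C')) := by
  rw [hollowBlocks, mul_signBlocks]
  ext (i | i | i) (j | j | j) <;>
  simp [hollowBlocks, mul_apply, Fintype.sum_sum_type, sub_eq_add_neg]

variable {A A' B B' C C'}

/-- The diagonal blocks of the polarized identity. The parameter t covers two equal normals (t = 2,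
the relation being doubled) and two distinct ones (t = 0). -/
theorem hollowBlocks_polarization {t : ℝ} (h : signBlocks p q k *
      (hollowBlocks A B C * hollowBlocks A' B' C' + hollowBlocks A' B' C' * hollowBlocks A B C) +
      (hollowBlocks A B C * signBlocks p q k * hollowBlocks A' B' C' +
        hollowBlocks A' B' C' * signBlocks p q k * hollowBlocks A B C) +
      (hollowBlocks A B C * hollowBlocks A' B' C' + hollowBlocks A' B' C' * hollowBlocks A B C) *
        signBlocks p q k = t • signBlocks p q k) :
    A * A'ᵀ + A' * Aᵀ + (2 : ℝ) • (B * B'ᵀ + B' * Bᵀ) = t • 1 ∧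
    Aᵀ * A' + A'ᵀ * A + (2 : ℝ) • (C * C'ᵀ + C' * Cᵀ) = t • 1 ∧
    Bᵀ * B' + B'ᵀ * B = Cᵀ * C' + C'ᵀ * C := by
  simp only [hollowBlocks_mul_signBlocks_mul, Matrix.mul_add, Matrix.add_mul, hollowBlocks_mul,
    signBlocks_mul, mul_signBlocks] at h
  simp only [signBlocks, fromBlocks_add, fromBlocks_smul] at h
  obtain ⟨h1, -, -, h4⟩ := fromBlocks_inj.mp h
  obtain ⟨h2, -, -, h3⟩ := fromBlocks_inj.mp h4
  refine ⟨?_, ?_, ?_⟩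
  · rw [← h1]; module
  · rw [smul_neg, ← neg_eq_iff_eq_neg] at h2
    rw [← h2]; module
  · rw [smul_zero] at h3
    rw [← sub_eq_zero, ← h3]; abel

end Blocks

/-! ### Solving the block equations against the normal form -/

section NormalForm

variable {a r : Type*} [Fintype r] [DecidableEq r]

theorem commute_inv_sq {σ Δ : Matrix r r ℝ} (hσ : IsUnit σ.det)
    (h : (2 : ℝ) • (σ * σ) = 1 + Δ * Δ) : Δ * (σ⁻¹ * σ⁻¹) = σ⁻¹ * σ⁻¹ * Δ := by
  have h1 : σ * σ * Δ = Δ * (σ * σ) := by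
    apply smul_right_injective _ (two_ne_zero (α := ℝ))
    change (2 : ℝ) • (σ * σ * Δ) = (2 : ℝ) • (Δ * (σ * σ))
    rw [← Matrix.smul_mul, ← Matrix.mul_smul Δ (2 : ℝ) (σ * σ), h]
    noncomm_ring
  have h2 : σ⁻¹ * σ⁻¹ * (σ * σ) = 1 := by
    rw [Matrix.mul_assoc, nonsing_inv_mul_cancel_left _ _ hσ, nonsing_inv_mul _ hσ]
  have h3 : σ * σ * (σ⁻¹ * σ⁻¹) = 1 := by
    rw [Matrix.mul_assoc, mul_nonsing_inv_cancel_left _ _ hσ, mul_nonsing_inv _ hσ]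
  calc Δ * (σ⁻¹ * σ⁻¹) = σ⁻¹ * σ⁻¹ * (σ * σ) * Δ * (σ⁻¹ * σ⁻¹) := by rw [h2, Matrix.one_mul]
    _ = σ⁻¹ * σ⁻¹ * (σ * σ * Δ) * (σ⁻¹ * σ⁻¹) := by simp only [Matrix.mul_assoc]
    _ = σ⁻¹ * σ⁻¹ * Δ * (σ * σ * (σ⁻¹ * σ⁻¹)) := by rw [h1]; simp only [Matrix.mul_assoc]
    _ = _ := by rw [h3, Matrix.mul_one]

theorem add_sq_mul_inv_sq {σ Δ : Matrix r r ℝ} (hσ : IsUnit σ.det)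
    (h : (2 : ℝ) • (σ * σ) = 1 + Δ * Δ) :
    σ⁻¹ * σ⁻¹ + Δ * (Δ * (σ⁻¹ * σ⁻¹)) = (2 : ℝ) • 1 := by
  have h3 : σ * σ * (σ⁻¹ * σ⁻¹) = 1 := by
    rw [Matrix.mul_assoc, mul_nonsing_inv_cancel_left _ _ hσ, mul_nonsing_inv _ hσ]
  rw [← h3, ← Matrix.smul_mul, h]
  noncomm_ring

variable {σ Δ : Matrix r r ℝ}

/-- A linear system for X and Y: eliminating one unknown multiplies the other by 1 + Δ² = 2σ², which
is invertible and commutes with Δ. -/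
theorem mixed_block_eq (hσ : IsUnit σ.det) (h : (2 : ℝ) • (σ * σ) = 1 + Δ * Δ)
    {X Y B C : Matrix a r ℝ} (h1 : Y - X * Δ + (2 : ℝ) • (B * σ) = 0)
    (h2 : X + Y * Δ + (2 : ℝ) • (C * σ) = 0) :
    X = B * σ⁻¹ * Δ - C * σ⁻¹ ∧ Y = -(B * σ⁻¹) - C * σ⁻¹ * Δ := by
  have hc := commute_inv_sq hσ h
  have hs := add_sq_mul_inv_sq hσ h
  have hB : B * σ⁻¹ = (-(2⁻¹) : ℝ) • ((Y - X * Δ) * (σ⁻¹ * σ⁻¹)) := by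
    rw [eq_neg_of_add_eq_zero_left h1, Matrix.neg_mul, Matrix.smul_mul, Matrix.mul_assoc B,
      mul_nonsing_inv_cancel_left _ _ hσ]
    module
  have hC : C * σ⁻¹ = (-(2⁻¹) : ℝ) • ((X + Y * Δ) * (σ⁻¹ * σ⁻¹)) := by
    rw [eq_neg_of_add_eq_zero_left h2, Matrix.neg_mul, Matrix.smul_mul, Matrix.mul_assoc C,
      mul_nonsing_inv_cancel_left _ _ hσ]
    module
  set W := σ⁻¹ * σ⁻¹ with hW
  have key : ∀ Z : Matrix a r ℝ, Z * W + Z * (Δ * (Δ * W)) = (2 : ℝ) • Z := by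
    intro Z
    rw [← Matrix.mul_add, hs, Matrix.mul_smul, Matrix.mul_one]
  constructor
  · rw [hB, hC]
    simp only [Matrix.smul_mul, Matrix.mul_assoc, Matrix.sub_mul, Matrix.add_mul, ← hc]
    rw [eq_sub_of_add_eq' (key X)]
    module
  · rw [hB, hC]
    simp only [Matrix.smul_mul, Matrix.mul_assoc, Matrix.sub_mul, Matrix.add_mul, ← hc]
    rw [eq_sub_of_add_eq' (key Y)]
    module

theorem corner_block_eq (hσ : IsUnit σ.det) (hσt : σᵀ = σ)
    (h : (2 : ℝ) • (σ * σ) = 1 + Δ * Δ) {X B C : Matrix r r ℝ}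
    (h1 : Δ * Xᵀ - X * Δ + (2 : ℝ) • (σ * Bᵀ + B * σ) = 0)
    (h2 : Xᵀ * Δ - Δ * X + (2 : ℝ) • (σ * Cᵀ + C * σ) = 0)
    (h3 : σ * B + Bᵀ * σ = σ * C + Cᵀ * σ)
    (h4 : X * (σ * σ) + σ * σ * Xᵀ + Δ * C * σ - σ * Cᵀ * Δ + Δ * σ * Bᵀ - B * σ * Δ = 0) :
    ((B - C) * σ⁻¹)ᵀ = -((B - C) * σ⁻¹) ∧
      X + Xᵀ = (B - C) * σ⁻¹ * Δ + Δ * ((B - C) * σ⁻¹) := by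
  set N := (B - C) * σ⁻¹ with hN
  have hB : B = C + N * σ := by
    rw [hN, nonsing_inv_mul_cancel_right _ _ hσ]; abel
  have hNt : Nᵀ = -N := by
    have e1 : σ * (B - C) = -((B - C)ᵀ * σ) := by
      rw [← add_eq_zero_iff_eq_neg, transpose_sub]
      rw [← sub_eq_zero] at h3
      rw [← h3]; noncomm_ring
    have e2 : B - C = -(σ⁻¹ * (B - C)ᵀ * σ) := by
      rw [Matrix.mul_assoc, ← Matrix.mul_neg, ← e1, nonsing_inv_mul_cancel_left _ _ hσ]
    rw [hN, transpose_mul, transpose_nonsing_inv, hσt]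
    nth_rewrite 2 [e2]
    rw [Matrix.neg_mul, mul_nonsing_inv_cancel_right _ _ hσ, neg_neg]
  refine ⟨hNt, ?_⟩
  have hBt : Bᵀ = Cᵀ - σ * N := by
    rw [hB, transpose_add, transpose_mul, hσt, hNt]; noncomm_ring
  set Z := X + Xᵀ - (N * Δ + Δ * N) with hZ
  rw [hBt, hB] at h1 h4
  have hs : σ * σ = (2⁻¹ : ℝ) • (1 + Δ * Δ) := by
    rw [← h, smul_smul]; norm_num
  have k1 : σ * (Cᵀ - σ * N) + (C + N * σ) * σ =
      σ * Cᵀ + C * σ + (N * (σ * σ) - σ * σ * N) := by noncomm_ring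
  have k2 : (2 : ℝ) • (σ * Cᵀ + C * σ) = Δ * X - Xᵀ * Δ := by
    rw [eq_neg_of_add_eq_zero_right h2]; abel
  have hcomm : Δ * Z = Z * Δ := by
    rw [k1, hs, smul_add, k2, Matrix.mul_smul, Matrix.smul_mul, ← smul_sub, smul_smul] at h1
    norm_num at h1
    rw [← sub_eq_zero, ← h1, hZ]
    noncomm_ring
  have k4 : X * (σ * σ) + σ * σ * Xᵀ + Δ * C * σ - σ * Cᵀ * Δ + Δ * σ * (Cᵀ - σ * N) -
      (C + N * σ) * σ * Δ = X * (σ * σ) + σ * σ * Xᵀ + (Δ * (σ * Cᵀ + C * σ) -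
        (σ * Cᵀ + C * σ) * Δ) - Δ * (σ * σ) * N - N * (σ * σ) * Δ := by noncomm_ring
  have h5 : Z + Z * (Δ * Δ) + Δ * Δ * Z - Δ * Z * Δ = 0 := by
    have k5 : ∀ Q G : Matrix r r ℝ,
        (2 : ℝ) • (X * Q + Q * Xᵀ + (Δ * G - G * Δ) - Δ * Q * N - N * Q * Δ) =
        X * ((2 : ℝ) • Q) + (2 : ℝ) • Q * Xᵀ + (Δ * ((2 : ℝ) • G) - (2 : ℝ) • G * Δ) -
        Δ * ((2 : ℝ) • Q) * N - N * ((2 : ℝ) • Q) * Δ := by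
      intro Q G
      simp only [smul_sub, smul_add, Matrix.mul_smul, Matrix.smul_mul]
    have e := congrArg (fun M => (2 : ℝ) • M) (k4.symm.trans h4)
    rw [k5, h, k2, smul_zero] at e
    rw [hZ, ← e]
    noncomm_ring
  have h6 : Z * (σ * σ) = 0 := by
    rw [hs, Matrix.mul_smul, Matrix.mul_add, Matrix.mul_one]
    have h7 : Δ * Z * Δ = Z * (Δ * Δ) := by rw [hcomm, Matrix.mul_assoc]
    have h8 : Δ * Δ * Z = Z * (Δ * Δ) := by rw [Matrix.mul_assoc, hcomm, ← Matrix.mul_assoc, h7]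
    rw [h7, h8, add_sub_cancel_right] at h5
    rw [h5, smul_zero]
  have h7 : Z = 0 := by
    have := congrArg (fun M => M * (σ⁻¹ * σ⁻¹)) h6
    simpa [Matrix.mul_assoc, mul_nonsing_inv_cancel_left _ _ hσ, mul_nonsing_inv _ hσ] using this
  exact sub_eq_zero.mp h7

end NormalForm

end ShapeMatrices

/-! ### Normalized bases: block relations and the null condition -/

section NormalizedBases

open Matrix

theorem deltaMatrix_transpose (k s : ℕ) (f : Fin s → ℝ) :
    (deltaMatrix k s f)ᵀ = -deltaMatrix k s f := by
  have h : (blockDiagonal fun t => !![0, f t; -f t, 0])ᵀ =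
      -blockDiagonal fun t => !![0, f t; -f t, 0] := by
    rw [blockDiagonal_transpose, ← blockDiagonal_neg]
    congr 1
    ext t i j
    fin_cases i <;> fin_cases j <;> simp
  ext i j
  obtain ⟨i, rfl⟩ := finSumFinEquiv.surjective i
  obtain ⟨j, rfl⟩ := finSumFinEquiv.surjective j
  rcases i with i | i <;> rcases j with j | j <;> simp [deltaMatrix]
  exact congrFun (congrFun h (i.modNat, i.divNat)) (j.modNat, j.divNat)

namespace IsSpectralData

variable {r : ℕ} {σ Δ : Matrix (Fin r) (Fin r) ℝ} (h : IsSpectralData σ Δ)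
include h

theorem transpose_left : σᵀ = σ := by
  obtain ⟨d, k, s, f, hr, hd, rfl, hf, hΔ, hk⟩ := h
  exact diagonal_transpose d

theorem isUnit_det : IsUnit σ.det := by
  obtain ⟨d, k, s, f, hr, hd, rfl, hf, hΔ, hk⟩ := h
  rw [det_diagonal, isUnit_iff_ne_zero]
  exact Finset.prod_ne_zero_iff.mpr fun i _ => hd i

theorem transpose_right : Δᵀ = -Δ := by
  obtain ⟨d, k, s, f, hr, hd, hσ, hf, rfl, hk⟩ := h
  rw [transpose_reindex, deltaMatrix_transpose]
  rfl

end IsSpectralData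

section Complexification

variable {p q k : Type*}

theorem map_ofReal_mul [Fintype q] (M : Matrix p q ℝ) (N : Matrix q k ℝ) :
    (M * N).map Complex.ofReal = M.map Complex.ofReal * N.map Complex.ofReal :=
  Matrix.map_mul (f := Complex.ofRealHom)

theorem map_ofReal_add (M N : Matrix p q ℝ) :
    (M + N).map Complex.ofReal = M.map Complex.ofReal + N.map Complex.ofReal :=
  Matrix.map_add _ Complex.ofReal_add M N

theorem map_ofReal_sub (M N : Matrix p q ℝ) :
    (M - N).map Complex.ofReal = M.map Complex.ofReal - N.map Complex.ofReal :=
  Matrix.map_sub _ Complex.ofReal_sub M N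

theorem map_ofReal_neg (M : Matrix p q ℝ) :
    (-M).map Complex.ofReal = -M.map Complex.ofReal := by
  ext i j; simp

theorem map_ofReal_nonsing_inv [Fintype p] [DecidableEq p] {M : Matrix p p ℝ}
    (hM : IsUnit M.det) : (M.map Complex.ofReal)⁻¹ = M⁻¹.map Complex.ofReal := by
  refine inv_eq_right_inv ?_
  rw [← map_ofReal_mul, mul_nonsing_inv _ hM]
  exact Matrix.map_one _ Complex.ofReal_zero Complex.ofReal_one

theorem dotProduct_mulVec_self_eq_zero [Fintype p] {M : Matrix p p ℂ} (hM : M + Mᵀ = 0)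
    (v : p → ℂ) : v ⬝ᵥ M *ᵥ v = 0 := by
  have h1 : v ⬝ᵥ Mᵀ *ᵥ v = v ⬝ᵥ M *ᵥ v := by
    rw [mulVec_transpose, dotProduct_comm, dotProduct_mulVec]
  have h2 : v ⬝ᵥ (M + Mᵀ) *ᵥ v = 0 := by rw [hM, zero_mulVec, dotProduct_zero]
  rw [add_mulVec, dotProduct_add, h1, ← two_mul] at h2
  exact (mul_eq_zero.mp h2).resolve_left two_ne_zero

variable [Fintype p] [Fintype q] [Fintype k]

theorem dotProduct_hollowBlocks_mulVec (A : Matrix p q ℝ) (B : Matrix p k ℝ) (C : Matrix q k ℝ)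
    (x : p → ℂ) (y : q → ℂ) (z : k → ℂ) :
    Sum.elim x (Sum.elim y z) ⬝ᵥ
      (hollowBlocks A B C).map Complex.ofReal *ᵥ Sum.elim x (Sum.elim y z) =
    2 * (x ⬝ᵥ A.map Complex.ofReal *ᵥ y + x ⬝ᵥ B.map Complex.ofReal *ᵥ z +
      y ⬝ᵥ C.map Complex.ofReal *ᵥ z) := by
  have h1 : y ⬝ᵥ (A.map Complex.ofReal)ᵀ *ᵥ x = x ⬝ᵥ A.map Complex.ofReal *ᵥ y := by
    rw [mulVec_transpose, dotProduct_comm, dotProduct_mulVec]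
  have h2 : z ⬝ᵥ (B.map Complex.ofReal)ᵀ *ᵥ x = x ⬝ᵥ B.map Complex.ofReal *ᵥ z := by
    rw [mulVec_transpose, dotProduct_comm, dotProduct_mulVec]
  have h3 : z ⬝ᵥ (C.map Complex.ofReal)ᵀ *ᵥ y = y ⬝ᵥ C.map Complex.ofReal *ᵥ z := by
    rw [mulVec_transpose, dotProduct_comm, dotProduct_mulVec]
  have e : (hollowBlocks A B C).map Complex.ofReal *ᵥ Sum.elim x (Sum.elim y z) =
      Sum.elim (A.map Complex.ofReal *ᵥ y + B.map Complex.ofReal *ᵥ z)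
        (Sum.elim ((A.map Complex.ofReal)ᵀ *ᵥ x + C.map Complex.ofReal *ᵥ z)
          ((B.map Complex.ofReal)ᵀ *ᵥ x + (C.map Complex.ofReal)ᵀ *ᵥ y)) := by
    ext (i | i | i) <;> simp [hollowBlocks, mulVec, dotProduct, Fintype.sum_sum_type]
  rw [e]
  simp only [sumElim_dotProduct_sumElim, dotProduct_add, h1, h2, h3]
  ring

end Complexification

namespace NormalBasis

variable {mp mm r : ℕ} {F : MvPolynomial (Fin (2 * (mp + mm) + 2)) ℝ} {x : Ambient mp mm}
  {D : NormalBasis mp mm r (focalPlus F) x} {σ Δ : Matrix (Fin r) (Fin r) ℝ}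

/-- Polarizing against S_0 multiplies the entry between eigenvalues ε and ε' by ε² + εε' + ε'². This
factor is 3 or 0 on the diagonal blocks, where the entry must therefore vanish, and 1 elsewhere. -/
theorem S_eq_hollowBlocks (hS : IsTripotentFamily D.S)
    (h0 : D.S 0 = diagonal (Sum.elim (fun _ => 1) (Sum.elim (fun _ => -1) fun _ => 0)))
    {a : Fin (mp + 1)} (ha : a ≠ 0) : D.S a = hollowBlocks (D.A a) (D.B a) (D.C a) := by
  have h1 := hS.polarize₂ ha.symm
  have h2 : ∀ i j, D.S a j i = D.S a i j := fun i j => congrFun (congrFun (D.S_transpose a) i) j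
  have h3 := fun i j => congrFun (congrFun h1 i) j
  simp only [h0, Matrix.add_apply, diagonal_mul_diagonal, diagonal_mul, mul_diagonal] at h3
  ext (i | i | i) (j | j | j)
  · have := h3 (Sum.inl i) (Sum.inl j)
    simp only [Sum.elim_inl] at this
    simp only [hollowBlocks, fromBlocks_apply₁₁, Matrix.zero_apply]
    linarith
  · rfl
  · rfl
  · exact h2 _ _
  · have := h3 (Sum.inr (Sum.inl i)) (Sum.inr (Sum.inl j))
    simp only [Sum.elim_inl, Sum.elim_inr] at this
    simp only [hollowBlocks, fromBlocks_apply₁₁, fromBlocks_apply₂₂, Matrix.zero_apply]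
    linarith
  · rfl
  · exact h2 _ _
  · exact h2 _ _
  · have := h3 (Sum.inr (Sum.inr i)) (Sum.inr (Sum.inr j))
    simp only [Sum.elim_inr] at this
    simp only [hollowBlocks, fromBlocks_apply₂₂, Matrix.zero_apply]
    linarith

section Relations

variable (hS : IsTripotentFamily D.S)
  (h0 : D.S 0 = diagonal (Sum.elim (fun _ => 1) (Sum.elim (fun _ => -1) fun _ => 0)))
include hS h0

theorem block_relations_self {a : Fin (mp + 1)} (ha : a ≠ 0) :
    D.A a * (D.A a)ᵀ + (2 : ℝ) • (D.B a * (D.B a)ᵀ) = 1 ∧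
    (D.A a)ᵀ * D.A a + (2 : ℝ) • (D.C a * (D.C a)ᵀ) = 1 := by
  have h1 := hS.polarize₂ ha
  rw [S_eq_hollowBlocks hS h0 ha, h0, diagonal_eq_signBlocks] at h1
  obtain ⟨e1, e2, -⟩ := hollowBlocks_polarization (A := D.A a) (A' := D.A a) (B := D.B a)
    (B' := D.B a) (C := D.C a) (C' := D.C a) (t := 2) (by
      conv_rhs => rw [← h1]
      rw [two_smul]
      noncomm_ring)
  constructor
  · apply smul_right_injective _ (two_ne_zero (α := ℝ))
    change (2 : ℝ) • _ = (2 : ℝ) • _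
    rw [← e1]
    module
  · apply smul_right_injective _ (two_ne_zero (α := ℝ))
    change (2 : ℝ) • _ = (2 : ℝ) • _
    rw [← e2]
    module

theorem block_relations {a b : Fin (mp + 1)} (ha : a ≠ 0) (hb : b ≠ 0) (hab : a ≠ b) :
    D.A a * (D.A b)ᵀ + D.A b * (D.A a)ᵀ +
      (2 : ℝ) • (D.B a * (D.B b)ᵀ + D.B b * (D.B a)ᵀ) = 0 ∧
    (D.A a)ᵀ * D.A b + (D.A b)ᵀ * D.A a +
      (2 : ℝ) • (D.C a * (D.C b)ᵀ + D.C b * (D.C a)ᵀ) = 0 ∧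
    (D.B a)ᵀ * D.B b + (D.B b)ᵀ * D.B a = (D.C a)ᵀ * D.C b + (D.C b)ᵀ * D.C a := by
  have h1 := hS.polarize₃ ha.symm hb.symm hab
  rw [S_eq_hollowBlocks hS h0 ha, S_eq_hollowBlocks hS h0 hb, h0, diagonal_eq_signBlocks] at h1
  simpa only [zero_smul] using hollowBlocks_polarization (t := 0) (by rw [h1, zero_smul])

/-- The E₊ block of a polarization not involving S_0, where S_b has zero block. The quadratic
relations alone give only commutation with Δ in `corner_block_eq`. -/
theorem triple_relation {a b : Fin (mp + 1)} (ha : a ≠ 0) (hb : b ≠ 0) (hab : a ≠ b) :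
    (D.B a * (D.C a)ᵀ * (D.A b)ᵀ + D.A a * D.C a * (D.B b)ᵀ) +
    (D.B a * (D.C b)ᵀ * (D.A a)ᵀ + D.A a * D.C b * (D.B a)ᵀ) +
    (D.B b * (D.C a)ᵀ * (D.A a)ᵀ + D.A b * D.C a * (D.B a)ᵀ) = 0 := by
  have h1 := hS.polarize₂ hab
  rw [S_eq_hollowBlocks hS h0 ha, S_eq_hollowBlocks hS h0 hb] at h1
  have h2 := congrArg toBlocks₁₁ h1
  rw [← hollowBlocks_mul_mul_toBlocks₁₁ (D.A a) (D.A a) (D.A b) _ (D.B a) _ (D.C a) _ (D.C b),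
    ← hollowBlocks_mul_mul_toBlocks₁₁ (D.A a) (D.A b) (D.A a) _ (D.B b) _ (D.C a) _ (D.C a),
    ← hollowBlocks_mul_mul_toBlocks₁₁ (D.A b) (D.A a) (D.A a) _ (D.B a) _ (D.C b) _ (D.C a)]
  rw [show toBlocks₁₁ (hollowBlocks (D.A b) (D.B b) (D.C b)) = 0 from rfl] at h2
  exact h2

end Relations

theorem IsNormalized.isTripotentFamily (hF : IsCartanMunzner mp mm F) (hx : x ∈ focalPlus F)
    (hD : D.IsNormalized σ Δ) : IsTripotentFamily D.S :=
  D.isTripotentFamily hF hx hD.le_mp hD.le_mm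

section NormalForm

variable (hF : IsCartanMunzner mp mm F) (hx : x ∈ focalPlus F) (hD : D.IsNormalized σ Δ)
include hF hx hD

theorem IsNormalized.two_smul_sq : (2 : ℝ) • (σ * σ) = 1 + Δ * Δ := by
  -- The literal 1 would wrap around to 0 in `Fin 1`; m₊ ≥ 1 excludes this.
  have h10 : (1 : Fin (mp + 1)) ≠ 0 := by
    have := hF.one_le_mp
    intro h
    have := congrArg Fin.val h
    rw [Fin.val_one', Nat.mod_eq_of_lt (by omega)] at this
    simp at this
  have h1 := (block_relations_self (hD.isTripotentFamily hF hx) hD.S_zero h10).1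
  rw [hD.A_one, hD.B_one] at h1
  simp only [fromBlocks_transpose, fromBlocks_multiply, fromBlocks_smul, fromBlocks_add,
    hD.spectral.transpose_left, hD.spectral.transpose_right] at h1
  rw [← fromBlocks_one] at h1
  have h2 := (fromBlocks_inj.mp h1).2.2.2
  rw [← h2]
  simp

theorem IsNormalized.sub_block_relations {l : Fin (mp + 1)} (hl : 2 ≤ (l : ℕ)) :
    (D.A l).toBlocks₁₁ + ((D.A l).toBlocks₁₁)ᵀ = 0 ∧
    (D.B l).toBlocks₂₁ = (D.C l).toBlocks₂₁ ∧
    ((D.A l).toBlocks₁₂ = (D.B l).toBlocks₁₂ * σ⁻¹ * Δ - (D.C l).toBlocks₁₂ * σ⁻¹ ∧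
      ((D.A l).toBlocks₂₁)ᵀ = -((D.B l).toBlocks₁₂ * σ⁻¹) - (D.C l).toBlocks₁₂ * σ⁻¹ * Δ) ∧
    ((((D.B l).toBlocks₂₂ - (D.C l).toBlocks₂₂) * σ⁻¹)ᵀ =
        -(((D.B l).toBlocks₂₂ - (D.C l).toBlocks₂₂) * σ⁻¹) ∧
      (D.A l).toBlocks₂₂ + ((D.A l).toBlocks₂₂)ᵀ =
        ((D.B l).toBlocks₂₂ - (D.C l).toBlocks₂₂) * σ⁻¹ * Δ +
          Δ * (((D.B l).toBlocks₂₂ - (D.C l).toBlocks₂₂) * σ⁻¹)) := by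
  have hv : ((1 : Fin (mp + 1)) : ℕ) = 1 := by
    have := hF.one_le_mp
    rw [Fin.val_one', Nat.mod_eq_of_lt (by omega)]
  have h10 : (1 : Fin (mp + 1)) ≠ 0 := fun h => by
    have := congrArg Fin.val h
    rw [hv] at this
    simp at this
  have hl0 : l ≠ 0 := fun h => by simp [h] at hl
  have h1l : 1 ≠ l := fun h => by rw [← h, hv] at hl; omega
  have hS := hD.isTripotentFamily hF hx
  have hσt := hD.spectral.transpose_left
  have hΔt := hD.spectral.transpose_right
  have hσ := hD.spectral.isUnit_det
  have h2 := hD.two_smul_sq hF hx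
  obtain ⟨e1, e2, e3⟩ := block_relations hS hD.S_zero h10 hl0 h1l
  have e4 := triple_relation hS hD.S_zero h10 hl0 h1l
  rw [hD.A_one, hD.B_one, ← fromBlocks_toBlocks (D.A l), ← fromBlocks_toBlocks (D.B l)] at e1
  rw [hD.A_one, hD.C_one, ← fromBlocks_toBlocks (D.A l), ← fromBlocks_toBlocks (D.C l)] at e2
  rw [hD.B_one, hD.C_one, ← fromBlocks_toBlocks (D.B l), ← fromBlocks_toBlocks (D.C l)] at e3
  rw [hD.A_one, hD.B_one, hD.C_one, ← fromBlocks_toBlocks (D.A l), ← fromBlocks_toBlocks (D.B l),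
    ← fromBlocks_toBlocks (D.C l)] at e4
  set A₁₁ := (D.A l).toBlocks₁₁
  set A₁₂ := (D.A l).toBlocks₁₂
  set A₂₁ := (D.A l).toBlocks₂₁
  set A₂₂ := (D.A l).toBlocks₂₂
  set B₁₁ := (D.B l).toBlocks₁₁
  set B₁₂ := (D.B l).toBlocks₁₂
  set B₂₁ := (D.B l).toBlocks₂₁
  set B₂₂ := (D.B l).toBlocks₂₂
  set C₁₁ := (D.C l).toBlocks₁₁
  set C₁₂ := (D.C l).toBlocks₁₂
  set C₂₁ := (D.C l).toBlocks₂₁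
  set C₂₂ := (D.C l).toBlocks₂₂
  simp only [fromBlocks_transpose, fromBlocks_multiply, fromBlocks_smul, fromBlocks_add, hσt, hΔt,
    transpose_zero, transpose_one, Matrix.mul_zero, Matrix.zero_mul, Matrix.mul_one,
    Matrix.one_mul, add_zero, zero_add, smul_zero, Matrix.mul_neg, Matrix.neg_mul] at e1 e2 e3 e4
  rw [← fromBlocks_zero] at e1 e2 e4
  obtain ⟨a11, a12, -, a22⟩ := fromBlocks_inj.mp e1
  obtain ⟨-, c12, -, c22⟩ := fromBlocks_inj.mp e2
  obtain ⟨-, -, d21, d22⟩ := fromBlocks_inj.mp e3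
  obtain ⟨-, -, -, f22⟩ := fromBlocks_inj.mp e4
  refine ⟨?_, ?_, mixed_block_eq hσ h2 ?_ ?_, corner_block_eq hσ hσt h2 ?_ ?_ d22 ?_⟩
  · rw [add_comm]; exact a11
  · have := congrArg (fun M => σ⁻¹ * M) d21
    simpa only [nonsing_inv_mul_cancel_left _ _ hσ] using this
  · rw [← a12]; abel
  · rw [← c12]
  · rw [← a22]; abel
  · rw [← c22]; abel
  · rw [← f22, ← Matrix.mul_assoc A₂₂]; abel

/-- The x₁x₁ and x₂x₂ terms vanish because their matrices are skew, the x₁x₂ term by the formulas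
for A₁₂ and A₂₁, and the x₂z₁ term because B₂₁ = C₂₁. Only x₁z₁ survives. -/
theorem IsNormalized.p_eq {l : Fin (mp + 1)} (hl : 2 ≤ (l : ℕ)) {ι : ℂ} (hι : ι * ι = -1)
    (x₁ : Fin (mm - r) → ℂ) (x₂ : Fin r → ℂ) (z₁ : Fin (mp - r) → ℂ) :
    D.p l (Sum.elim (Sum.elim x₁ x₂) (Sum.elim (Sum.elim (ι • x₁) (-x₂)) (Sum.elim z₁
      (((σ.map Complex.ofReal)⁻¹ * (Δ.map Complex.ofReal + ι • 1)) *ᵥ x₂)))) =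
    2 * (x₁ ⬝ᵥ (D.B l).toBlocks₁₁.map Complex.ofReal *ᵥ z₁ +
      ι * (x₁ ⬝ᵥ (D.C l).toBlocks₁₁.map Complex.ofReal *ᵥ z₁)) := by
  have hl0 : l ≠ 0 := fun h => by simp [h] at hl
  obtain ⟨r1, r2, ⟨r3, r4⟩, r5, r6⟩ := hD.sub_block_relations hF hx hl
  have hΔt := hD.spectral.transpose_right
  rw [map_ofReal_nonsing_inv hD.spectral.isUnit_det]
  rw [p, S_eq_hollowBlocks (hD.isTripotentFamily hF hx) hD.S_zero hl0,
    dotProduct_hollowBlocks_mulVec]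
  rw [← fromBlocks_toBlocks (D.A l), ← fromBlocks_toBlocks (D.B l), ← fromBlocks_toBlocks (D.C l)]
  simp only [toBlocks_fromBlocks₁₁]
  set A₁₁ := (D.A l).toBlocks₁₁
  set A₁₂ := (D.A l).toBlocks₁₂
  set A₂₁ := (D.A l).toBlocks₂₁
  set A₂₂ := (D.A l).toBlocks₂₂
  set B₁₁ := (D.B l).toBlocks₁₁
  set B₁₂ := (D.B l).toBlocks₁₂
  set B₂₁ := (D.B l).toBlocks₂₁
  set B₂₂ := (D.B l).toBlocks₂₂
  set C₁₁ := (D.C l).toBlocks₁₁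
  set C₁₂ := (D.C l).toBlocks₁₂
  set C₂₁ := (D.C l).toBlocks₂₁
  set C₂₂ := (D.C l).toBlocks₂₂
  set K := σ⁻¹.map Complex.ofReal * (Δ.map Complex.ofReal + ι • 1) with hK
  have s1 : x₁ ⬝ᵥ A₁₁.map Complex.ofReal *ᵥ x₁ = 0 := by
    refine dotProduct_mulVec_self_eq_zero ?_ x₁
    rw [← transpose_map, ← map_ofReal_add, r1]
    ext; simp
  have s2 : -A₁₂.map Complex.ofReal + ι • (A₂₁.map Complex.ofReal)ᵀ +
      (B₁₂.map Complex.ofReal + ι • C₁₂.map Complex.ofReal) * K = 0 := by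
    rw [← transpose_map, r3, r4, hK]
    simp only [map_ofReal_sub, map_ofReal_mul, map_ofReal_neg, Matrix.add_mul, Matrix.mul_add,
      Matrix.mul_smul, Matrix.smul_mul, Matrix.mul_one, smul_add, smul_sub, smul_neg, smul_smul,
      hι, Matrix.mul_assoc, neg_smul, one_smul]
    abel
  have s3 : x₂ ⬝ᵥ (-A₂₂.map Complex.ofReal +
      (B₂₂.map Complex.ofReal - C₂₂.map Complex.ofReal) * K) *ᵥ x₂ = 0 := by
    refine dotProduct_mulVec_self_eq_zero ?_ x₂
    set N := (B₂₂ - C₂₂) * σ⁻¹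
    have e : (B₂₂.map Complex.ofReal - C₂₂.map Complex.ofReal) * K =
        (N * Δ).map Complex.ofReal + ι • N.map Complex.ofReal := by
      rw [hK, ← map_ofReal_sub, ← Matrix.mul_assoc, ← map_ofReal_mul, Matrix.mul_add,
        ← map_ofReal_mul, Matrix.mul_smul, Matrix.mul_one]
    have e' : (N * Δ)ᵀ = Δ * N := by
      rw [transpose_mul, hΔt, r5, Matrix.neg_mul, Matrix.mul_neg, neg_neg]
    have e'' : A₂₂.map Complex.ofReal + (A₂₂ᵀ).map Complex.ofReal =
        (N * Δ).map Complex.ofReal + (Δ * N).map Complex.ofReal := by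
      rw [← map_ofReal_add, r6, map_ofReal_add]
    rw [e]
    simp only [transpose_add, transpose_neg, transpose_smul, ← transpose_map, e', r5,
      map_ofReal_neg]
    rw [← sub_eq_zero.mpr e''.symm, smul_neg]
    abel
  have s2' : x₁ ⬝ᵥ (-A₁₂.map Complex.ofReal + ι • (A₂₁.map Complex.ofReal)ᵀ +
      (B₁₂.map Complex.ofReal + ι • C₁₂.map Complex.ofReal) * K) *ᵥ x₂ = 0 := by
    rw [s2, zero_mulVec, dotProduct_zero]
  have s4 : x₂ ⬝ᵥ A₂₁.map Complex.ofReal *ᵥ x₁ = x₁ ⬝ᵥ (A₂₁.map Complex.ofReal)ᵀ *ᵥ x₂ := by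
    rw [mulVec_transpose, dotProduct_comm x₁, dotProduct_mulVec]
  rw [r2]
  simp only [fromBlocks_map, fromBlocks_mulVec, Sum.elim_comp_inl, Sum.elim_comp_inr,
    sumElim_dotProduct_sumElim, dotProduct_add, smul_dotProduct, dotProduct_smul, mulVec_smul,
    mulVec_neg, dotProduct_neg, neg_dotProduct, smul_eq_mul, s1, s4]
  simp only [add_mulVec, sub_mulVec, neg_mulVec, smul_mulVec, ← mulVec_mulVec, dotProduct_add,
    dotProduct_sub, dotProduct_neg, dotProduct_smul, smul_eq_mul] at s2' s3
  linear_combination 2 * s2' + 2 * s3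

theorem IsNormalized.isNullAt_iff {l : Fin (mp + 1)} (hl : 2 ≤ (l : ℕ)) :
    D.IsNullAt σ Δ l ↔ (D.B l).toBlocks₁₁ = 0 ∧ (D.C l).toBlocks₁₁ = 0 := by
  constructor
  · intro h
    have key : ∀ i j, (D.B l).toBlocks₁₁ i j = 0 ∧ (D.C l).toBlocks₁₁ i j = 0 := by
      intro i j
      -- Coordinate vectors x₁, z₁ with x₂ = 0 satisfy the constraints and isolate one entry of B₁₁
      -- + iC₁₁, whose real and imaginary parts are the two real entries.
      have h1 := hD.p_eq hF hx hl Complex.I_mul_I (Pi.single i 1) 0 (Pi.single j 1)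
      rw [h _ ⟨Complex.I, Or.inl rfl, rfl, rfl, rfl⟩] at h1
      simp only [single_one_dotProduct, mulVec_single_one, col_apply, map_apply] at h1
      have h2 := congrArg Complex.re h1
      have h3 := congrArg Complex.im h1
      simp at h2 h3
      exact ⟨h2, h3⟩
    exact ⟨Matrix.ext fun i j => (key i j).1, Matrix.ext fun i j => (key i j).2⟩
  · rintro ⟨hB, hC⟩ v ⟨ι, hι, hy₁, hy₂, hz₂⟩
    have hι2 : ι * ι = -1 := by
      rcases hι with rfl | rfl <;> simp
    have hv : v = Sum.elim (Sum.elim (fun i => v (Sum.inl (Sum.inl i)))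
        (fun i => v (Sum.inl (Sum.inr i)))) (Sum.elim (Sum.elim
        (ι • fun i => v (Sum.inl (Sum.inl i))) (-fun i => v (Sum.inl (Sum.inr i))))
        (Sum.elim (fun i => v (Sum.inr (Sum.inr (Sum.inl i))))
        (((σ.map Complex.ofReal)⁻¹ * (Δ.map Complex.ofReal + ι • 1)) *ᵥ
          fun i => v (Sum.inl (Sum.inr i))))) := by
      rw [← hy₁, ← hy₂, ← hz₂]
      ext ((i | i) | (i | i) | (i | i)) <;> rfl
    rw [hv, hD.p_eq hF hx hl hι2, hB, hC]
    simp

end NormalForm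

end NormalBasis

end NormalizedBases

/-- When X_0² acts as the identity on the family, X_0 anticommutes with the other members, as in a
Clifford system, so every unit combination has the same square. -/
theorem IsTripotentFamily.sq_eq_of_mul_sq {R : Type*} [Ring R] [Algebra ℝ R] {m : ℕ}
    {X : Fin (m + 1) → R} (h : IsTripotentFamily X) (hr : ∀ a, X a * (X 0 * X 0) = X a)
    (hl : ∀ a, X 0 * X 0 * X a = X a) {c : Fin (m + 1) → ℝ} (hc : ∑ a, c a ^ 2 = 1) :
    (∑ a, c a • X a) * (∑ a, c a • X a) = X 0 * X 0 := by
  have anti : ∀ a, a ≠ 0 → X 0 * X a + X a * X 0 = 0 := by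
    intro a ha
    have h1 := h.polarize₂ ha.symm
    rw [hl, mul_assoc (X a), hr] at h1
    have h2 : X 0 * X a * X 0 = -X a := by
      rw [← sub_eq_zero, sub_neg_eq_add]
      calc X 0 * X a * X 0 + X a = X a + X 0 * X a * X 0 + X a - X a := by abel
        _ = 0 := by rw [h1, sub_self]
    have h3 : X 0 * (X a * (X 0 * X 0)) = -(X a * X 0) := by
      rw [← neg_mul, ← h2]; noncomm_ring
    rw [hr] at h3
    rw [h3]; abel
  set M := ∑ a, c a • X a with hM
  have hMr : M * (X 0 * X 0) = M := by
    simp only [hM, Finset.sum_mul, smul_mul_assoc, hr]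
  have hMl : X 0 * X 0 * M = M := by
    simp only [hM, Finset.mul_sum, mul_smul_comm, hl]
  have hM0 : X 0 * M + M * X 0 = (2 * c 0) • (X 0 * X 0) := by
    simp only [hM, Finset.sum_mul, Finset.mul_sum, smul_mul_assoc, mul_smul_comm,
      ← Finset.sum_add_distrib, ← smul_add]
    rw [Finset.sum_eq_single 0 (fun a _ ha => by rw [anti a ha, smul_zero]) (by simp)]
    module
  have hcube : ∀ t : ℝ, (M + t • X 0) ^ 3 = (1 + 2 * t * c 0 + t ^ 2) • (M + t • X 0) := by
    intro t
    have h1 := h (c + Pi.single 0 t)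
    have e1 : ∑ a, (c + Pi.single 0 t : Fin (m + 1) → ℝ) a • X a = M + t • X 0 := by
      simp [Pi.single_apply, add_smul, Finset.sum_add_distrib, hM]
    have e2 : ∑ a, (c + Pi.single 0 t : Fin (m + 1) → ℝ) a ^ 2 = 1 + 2 * t * c 0 + t ^ 2 := by
      simp only [Pi.add_apply, add_sq, Finset.sum_add_distrib, hc, Pi.single_apply]
      simp
      ring
    rwa [e1, e2] at h1
  have h1 := hcube 1
  have h2 := hcube (-1)
  have h3 := h.pow_three 0
  have e : (2 : ℝ) • (M * M * X 0 + M * X 0 * M + X 0 * M * M) =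
      (M + (1 : ℝ) • X 0) ^ 3 - (M + (-1 : ℝ) • X 0) ^ 3 - (2 : ℝ) • X 0 ^ 3 := by
    simp only [one_smul, neg_smul, two_smul]
    noncomm_ring
  rw [h1, h2, h3] at e
  have e' : M * M * X 0 + M * X 0 * M + X 0 * M * M = X 0 + (2 * c 0) • M := by
    apply smul_right_injective R (two_ne_zero (α := ℝ))
    change (2 : ℝ) • _ = (2 : ℝ) • _
    rw [e]; module
  -- By anticommutation M X_0 + X_0 M = 2c_0 X_0², so these terms cancel the 2c_0 M in the polarized
  -- identity and leave M² X_0 = X_0.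
  have e'' : M * X 0 * M + X 0 * M * M = (2 * c 0) • M := by
    rw [← add_mul, add_comm (M * X 0), hM0, smul_mul_assoc, hMl]
  rw [add_assoc, e''] at e'
  have e3 : M * M * X 0 = X 0 := add_right_cancel e'
  calc M * M = M * (M * (X 0 * X 0)) := by rw [hMr]
    _ = M * M * X 0 * X 0 := by noncomm_ring
    _ = X 0 * X 0 := by rw [e3]

/-! ### Condition A and the vanishing of B and C -/

section ConditionA

open Matrix

namespace NormalBasis

variable {mp mm r : ℕ} {F : MvPolynomial (Fin (2 * (mp + mm) + 2)) ℝ} {x : Ambient mp mm}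
  {D : NormalBasis mp mm r (focalPlus F) x} {σ Δ : Matrix (Fin r) (Fin r) ℝ}

theorem apply_eq_zero_iff {M : Set (Ambient mp mm)} (D : NormalBasis mp mm r M x)
    (c : Fin (mp + 1) → ℝ) (v : D.T) :
    (∑ a, c a • D.shape a) v = 0 ↔ (∑ a, c a • D.S a) *ᵥ D.e.toBasis.repr v = 0 := by
  have e : ∑ a, c a • D.S a =
      LinearMap.toMatrix D.e.toBasis D.e.toBasis (∑ a, c a • D.shape a) := by
    simp only [map_sum, map_smul, S_eq_toMatrix]
  rw [e, LinearMap.toMatrix_mulVec_repr, Finsupp.coe_eq_zero]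
  exact (LinearEquiv.map_eq_zero_iff _).symm

/-- The frame vectors of E₀ span ker S_0. A common kernel makes every S_a kill them, so the E₀
columns vanish. -/
theorem IsNormalized.eq_zero_of_conditionA (hF : IsCartanMunzner mp mm F) (hx : x ∈ focalPlus F)
    (hD : D.IsNormalized σ Δ) (hA : ConditionA (focalPlus F) x) (a : Fin (mp + 1)) :
    D.B a = 0 ∧ D.C a = 0 := by
  obtain ⟨T, hT, K, hK⟩ := hA
  obtain rfl : T = D.T := SetLike.coe_injective (hT.trans D.isTangentSpace.symm)
  have hker : ∀ b, LinearMap.ker (D.shape b) = K := by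
    intro b
    have hmem : D.n b ∈ normalSpaceInSphere x D.T := by
      rw [← D.span_n]; exact Submodule.subset_span ⟨b, rfl⟩
    -- Condition A only supplies some shape operator; by uniqueness it is the one in the basis data.
    obtain ⟨S, hS, rfl⟩ := hK (D.n b) hmem (D.orthonormal_n.1 b)
    congr 1
    ext1 v
    apply Subtype.ext
    apply WithLp.ofLp_injective 2
    have hdim := D.finrank_tangent hD.le_mp hD.le_mm
    rw [hS.apply_eq hF hx hT hdim hmem (D.orthonormal_n.1 b),
      (D.isShapeOperator b).apply_eq hF hx hT hdim hmem (D.orthonormal_n.1 b)]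
  have hcol : ∀ j i, D.S a i (Sum.inr (Sum.inr j)) = 0 := by
    intro j i
    have h0 : D.shape 0 (D.e (Sum.inr (Sum.inr j))) = 0 := by
      refine InnerProductSpace.ext_inner_left_basis (𝕜 := ℝ) D.e.toBasis fun i => ?_
      have h1 := congrFun (congrFun hD.S_zero i) (Sum.inr (Sum.inr j))
      rw [OrthonormalBasis.coe_toBasis, inner_zero_right]
      refine h1.trans ?_
      rw [diagonal_apply]
      split_ifs with h
      · rw [h]; rfl
      · rfl
    have ha : D.e (Sum.inr (Sum.inr j)) ∈ LinearMap.ker (D.shape a) := by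
      rw [hker a, ← hker 0]; exact h0
    change ⟪D.e i, D.shape a (D.e (Sum.inr (Sum.inr j)))⟫ = 0
    rw [LinearMap.mem_ker.mp ha, inner_zero_right]
  exact ⟨Matrix.ext fun i j => hcol j _, Matrix.ext fun i j => hcol j _⟩

/-- With B and C zero, S_0² is the projection onto E₊ ⊕ E₋ and fixes every S_a on both sides. Then
S_n² = S_0², and each of S_n, S_0 kills the kernel of the other. -/
theorem IsNormalized.conditionA_of_eq_zero (hF : IsCartanMunzner mp mm F) (hx : x ∈ focalPlus F)
    (hD : D.IsNormalized σ Δ) (h : ∀ a, a ≠ 0 → D.B a = 0 ∧ D.C a = 0) :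
    ConditionA (focalPlus F) x := by
  refine ⟨D.T, D.isTangentSpace, LinearMap.ker (D.shape 0), fun n hn hn1 => ?_⟩
  rw [← D.span_n, Submodule.mem_span_range_iff_exists_fun] at hn
  obtain ⟨c, rfl⟩ := hn
  refine ⟨∑ a, c a • D.shape a, IsShapeOperator.sum_smul D.isShapeOperator c, ?_⟩
  have hc : ∑ a, c a ^ 2 = 1 := by rw [← D.norm_sum_smul_sq, hn1, one_pow]
  have hS := hD.isTripotentFamily hF hx
  have hr : ∀ a, D.S a * (D.S 0 * D.S 0) = D.S a := by
    intro a
    rcases eq_or_ne a 0 with rfl | ha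
    · rw [← Matrix.mul_assoc, ← pow_three', hS.pow_three]
    · rw [S_eq_hollowBlocks hS hD.S_zero ha, (h a ha).1, (h a ha).2, hD.S_zero,
        diagonal_mul_diagonal]
      ext (i | i | i) (j | j | j) <;> simp [hollowBlocks, mul_diagonal]
  have hl : ∀ a, D.S 0 * D.S 0 * D.S a = D.S a := by
    intro a
    have := congrArg transpose (hr a)
    simpa only [transpose_mul, D.S_transpose] using this
  have hsq := hS.sq_eq_of_mul_sq hr hl hc
  have h0 : D.shape 0 = ∑ a, (Pi.single 0 1 : Fin (mp + 1) → ℝ) a • D.shape a := by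
    simp [Pi.single_apply]
  have h0' : D.S 0 = ∑ a, (Pi.single 0 1 : Fin (mp + 1) → ℝ) a • D.S a := by
    simp [Pi.single_apply]
  have hM : (∑ a, c a • D.S a) * (D.S 0 * D.S 0) = ∑ a, c a • D.S a := by
    simp only [Finset.sum_mul, Matrix.smul_mul, hr]
  ext v
  rw [LinearMap.mem_ker, LinearMap.mem_ker, h0, D.apply_eq_zero_iff, D.apply_eq_zero_iff, ← h0']
  constructor
  · intro hv
    rw [← hr 0, ← hsq, ← mulVec_mulVec, ← mulVec_mulVec, hv, mulVec_zero, mulVec_zero]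
  · intro hv
    rw [← hM, ← mulVec_mulVec, ← mulVec_mulVec, hv, mulVec_zero, mulVec_zero]

theorem IsNormalized.conditionA_iff (hF : IsCartanMunzner mp mm F) (hx : x ∈ focalPlus F)
    (hD : D.IsNormalized σ Δ) :
    ConditionA (focalPlus F) x ↔ r = 0 ∧ D.IsNull σ Δ := by
  constructor
  · intro hA
    have hBC := hD.eq_zero_of_conditionA hF hx hA
    constructor
    · by_contra hr
      have : Nonempty (Fin r) := ⟨⟨0, Nat.pos_of_ne_zero hr⟩⟩
      have h1 := hD.B_one
      rw [(hBC 1).1, ← fromBlocks_zero] at h1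
      have h2 := hD.spectral.isUnit_det
      rw [← (fromBlocks_inj.mp h1).2.2.2, det_zero] at h2
      exact not_isUnit_zero h2
    · intro l hl
      rw [hD.isNullAt_iff hF hx hl, (hBC l).1, (hBC l).2]
      exact ⟨rfl, rfl⟩
  · rintro ⟨rfl, hN⟩
    refine hD.conditionA_of_eq_zero hF hx fun a ha => ?_
    have key : (D.B a).toBlocks₁₁ = 0 ∧ (D.C a).toBlocks₁₁ = 0 := by
      by_cases h2 : 2 ≤ (a : ℕ)
      · exact (hD.isNullAt_iff hF hx h2).mp (hN a h2)
      -- Nullity concerns only l ≥ 2; for index 1 the normal form of rank 0 gives the vanishing.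
      · have h1 : a = 1 := by
          have := hF.one_le_mp
          apply Fin.ext
          rw [Fin.val_one', Nat.mod_eq_of_lt (by omega)]
          have : (a : ℕ) ≠ 0 := fun h => ha (Fin.ext h)
          omega
        rw [h1, hD.B_one, hD.C_one]
        exact ⟨rfl, rfl⟩
    constructor
    · ext (i | i) (j | j)
      exacts [congrFun (congrFun key.1 i) j, j.elim0, i.elim0, j.elim0]
    · ext (i | i) (j | j)
      exacts [congrFun (congrFun key.2 i) j, j.elim0, i.elim0, j.elim0]

end NormalBasis

end ConditionA

theorem mainTheorem5 (mp mm r : ℕ) (F : MvPolynomial (Fin (2 * (mp + mm) + 2)) ℝ)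
    (hF : IsCartanMunzner mp mm F) (x : Ambient mp mm) (hx : x ∈ focalPlus F)
    (D : NormalBasis mp mm r (focalPlus F) x) (σ Δ : Matrix (Fin r) (Fin r) ℝ)
    (hD : D.IsNormalized σ Δ) :
    (∀ l : Fin (mp + 1), 2 ≤ (l : ℕ) →
      (D.IsNullAt σ Δ l ↔ (D.B l).toBlocks₁₁ = 0 ∧ (D.C l).toBlocks₁₁ = 0)) ∧
    (ConditionA (focalPlus F) x ↔ r = 0 ∧ D.IsNull σ Δ) ∧
    (ConditionA (focalPlus F) x ↔
      ∀ (r' : ℕ) (D' : NormalBasis mp mm r' (focalPlus F) x) (σ' Δ' : Matrix (Fin r') (Fin r') ℝ),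
        D'.IsNormalized σ' Δ' → r' = 0 ∧ D'.IsNull σ' Δ') := by

  refine ⟨fun l hl => hD.isNullAt_iff hF hx hl, hD.conditionA_iff hF hx, ?_⟩
  exact ⟨fun hA r' D' σ' Δ' hD' => (hD'.conditionA_iff hF hx).mp hA,
    fun h => (hD.conditionA_iff hF hx).mpr (h r D σ Δ hD)⟩
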